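/- Theorem 3 (the optimal stopping rule for network aware decision making is a network-state-dependent threshold rule). **Network.** Time is slotted. $N\ge 1$ sensors sample synchronously every $m=1/r\in\{1,2,\dots\}$ slots; batch $b\ge1$ is sampled at time $bm$. Each sensor $i$ keeps its samples in a FIFO queue, of length $L^{(i)}_k$ just after the beginning of slot $k$, with $L^{(i)}_0=0$. If $n\ge 1$ queues are nonempty in slot $k$, then with probability $\sigma\in(0,1)$ one packet is successfully transmitted, from a node chosen uniformly among these $n$ nodes; otherwise no packet is transmitted. Let $M_k\in\{0,1,\dots,N\}$ be the transmitting node ($0$ if none); a sample transmitted in slot $k$ reaches the fusion center at time $k+1$. There the samples are handed to the decision maker batch by batch: a received sample of the batch currently being processed is handed over at once, samples of later batches wait in sequencing queues, and when the last component of the current batch arrives, the head-of-line sequenced samples (those of the next batch) are handed over with it and the next batch becomes the current one. Let $B_k$ be the index of the current batch ($B_0=1$), $W^{(i)}_k$ the length of the $i$-th sequencing queue, $R^{(i)}_k\in\{0,1\}$ the indicator that component $i$ of batch $B_k$ has been received by the decision maker, $\lambda_k=m-(k\bmod m)$, $\Delta_k=\max\{k-B_km,0\}$, and let $Q_k=[\lambda_k,B_k,\Delta_k,W_k,R_k]$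 be the observable queueing state. **Change and observations.** The change time $T$ satisfies $P(T=0)=\rho\in[0,1]$ and $P(T=k)=(1-\rho)p(1-p)^{k-1}$ for $k\ge1$, with $0<p<1$. Given $T$, the samples $X^{(i)}_b$ are independent, with law $F_0$ if $bm<T$ and $F_1$ if $bm\ge T$ ($F_0,F_1$ arbitrary probability measures on a measurable space). The process $(M_k)$ is independent of $T$ and of the samples. At time $k$ the decision maker observes $Z_k=[Q_k,Y_k]$, where $Y_k$ is the (possibly empty) vector of samples handed over at time $k$; let $\mathcal I_k=\sigma(Z_0,\dots,Z_k)$ and $\Pi_k=P(T\le k\mid \mathcal I_k)$. **Claim.** Fix $N,m,\sigma,p,F_0,F_1$ and a delay cost $c>0$. For every $\rho\in[0,1]$ there are thresholds $\gamma(q)\in[0,1]$, one for each queueing state $q$, such that the rule $$\tau^*=\inf\{k\ge0:\Pi_k\ge\gamma(Q_k)\}\qquad(\inf\emptyset=\infty)$$ is a stopping time with respect to $(\mathcal I_k)$ and minimizes the Bayesian risk $$P(\tau<T)+c\,\mathsf E[(\tau-T)^+]$$ over all stopping times $\tau$ with respect to $(\mathcal I_k)$ with values in $\{0,1,2,\dots\}\cup\{\infty\}$.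 Moreover, the thresholds $\gamma(q)$ can be chosen independent of $\rho$, except possibly for the initial queueing state $q=Q_0=[m,1,0,\mathbf 0,\mathbf 0]$. -/

import Mathlib

open MeasureTheory ProbabilityTheory
open scoped ENNReal

namespace NADM

/-! ### The queueing network

`N` sensors, sampling period `m` slots (the reciprocal of the sampling rate); batch `b ≥ 1` is
sampled by all sensors at the time instant `b * m`.  The outcome of slot `k` is an element of
`Fin (N + 1)`: `0` means that there is no successful transmission in the slot, `j.succ` means that
node `j : Fin N` successfully transmits the packet at the head of its queue. -/

/-- Configuration of sensor queues, sequencer and decision maker in a slot: `B` is the index of the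
batch being processed, `L i` the queue length at sensor `i` (just after the beginning of the slot),
`W i` the length of the `i`-th sequencing queue, and `R i` tells whether the component `i` of
batch `B` has been received by the decision maker. -/
@[ext] structure NetState (N : ℕ) where
  B : ℕ
  L : Fin N → ℕ
  W : Fin N → ℕ
  R : Fin N → Bool

/-- The network state observed by the decision maker, `Q = [lam, B, Δ, W, R]`. -/
@[ext] structure QueueState (N : ℕ) where
  lam : ℕ
  B : ℕ
  Δ : ℕ
  W : Fin N → ℕ
  R : Fin N → Bool

instance (N : ℕ) : MeasurableSpace (NetState N) := ⊤
instance (N : ℕ) : MeasurableSpace (QueueState N) := ⊤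

/-- Number of slots to go for the next sampling instant, at the beginning of slot `k`. -/
def slotsToGo (m k : ℕ) : ℕ := m - k % m

/-- The component `j` is the only component of the current batch not received so far. -/
def IsLast {N : ℕ} (s : NetState N) (j : Fin N) : Prop :=
  s.R j = false ∧ ∀ i, i ≠ j → s.R i = true

open Classical in
/-- Configuration in slot `k + 1`, given the configuration `s` and the outcome of slot `k`. -/
noncomputable def netStep {N : ℕ} (m k : ℕ) (s : NetState N) (o : Fin (N + 1)) : NetState N where
  B := if ∃ j : Fin N, o = j.succ ∧ IsLast s j then s.B + 1 else s.B
  L := fun i => s.L i - (if o = i.succ then 1 else 0) + (if slotsToGo m (k + 1) = m then 1 else 0)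
  W := fun i =>
    if ∃ j : Fin N, o = j.succ ∧ IsLast s j then s.W i - 1
    else if o = i.succ ∧ s.R i = true then s.W i + 1
    else s.W i
  R := fun i =>
    if ∃ j : Fin N, o = j.succ ∧ IsLast s j then decide (0 < s.W i)
    else if o = i.succ then true
    else s.R i

/-- Configuration in slot `k` when the slot outcomes are `o 0, o 1, …`
(it depends on `o 0, …, o (k - 1)` only). -/
noncomputable def netState {N : ℕ} (m : ℕ) (o : ℕ → Fin (N + 1)) : ℕ → NetState N
  | 0 => { B := 1, L := fun _ => 0, W := fun _ => 0, R := fun _ => false }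
  | k + 1 => netStep m k (netState m o k) (o k)

/-- The network state at time `k`; `Δ = max (k - B * m) 0`. -/
noncomputable def queueState {N : ℕ} (m : ℕ) (o : ℕ → Fin (N + 1)) (k : ℕ) : QueueState N where
  lam := slotsToGo m k
  B := (netState m o k).B
  Δ := k - (netState m o k).B * m
  W := (netState m o k).W
  R := (netState m o k).R

/-- The network state at time `0`. -/
def initialQueueState (N m : ℕ) : QueueState N where
  lam := m
  B := 1
  Δ := 0
  W := fun _ => 0
  R := fun _ => false

/-- Number of nodes contending for the slot. -/
def contenders {N : ℕ} (s : NetState N) : ℕ := (Finset.univ.filter fun i => 0 < s.L i).card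

/-- Probability of the outcome of a slot, given the configuration: if some queue is nonempty, there
is a success with probability `σ`, and it is ascribed uniformly to one of the contending nodes. -/
noncomputable def outcomeProb {N : ℕ} (σ : ℝ) (s : NetState N) (o : Fin (N + 1)) : ℝ :=
  Fin.cases (motive := fun _ => ℝ)
    (if contenders s = 0 then 1 else 1 - σ)
    (fun j => if 0 < s.L j then σ / contenders s else 0) o

open Classical in
/-- Index of the batch whose component `i` is handed to the decision maker as a result of the slot
outcome `o` in configuration `s` (`none` if no sample of node `i` is handed over).  A current sample
is handed over at once; when it completes batch `B`, the head-of-line samples (of batch `B + 1`)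
in the sequencing queues are handed over as well. -/
noncomputable def delivered {N : ℕ} (s : NetState N) (o : Fin (N + 1)) (i : Fin N) : Option ℕ :=
  if o = i.succ ∧ s.R i = false then some s.B
  else if (∃ j : Fin N, o = j.succ ∧ IsLast s j) ∧ 0 < s.W i then some (s.B + 1)
  else none

/-! ### The probabilistic model -/

section Model

variable {Ω 𝒳 : Type*} [MeasurableSpace Ω] [MeasurableSpace 𝒳] {N : ℕ}

/-- `T` is the change time, `M k` the outcome of slot `k`, and `X b i` the sample taken by sensor `i`
in batch `b ≥ 1`.  The change time has the (zero-modified) geometric law with parameters `ρ, p`;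
given the change time the samples are independent with law `F₁` if taken at or after the change
and `F₀` if taken before; the slot outcomes follow the contention model with success rate `σ`
and are independent of the change time and of the samples. -/
structure IsModel (m : ℕ) (σ p ρ : ℝ) (F₀ F₁ : Measure 𝒳) (μ : Measure Ω)
    (T : Ω → ℕ) (M : ℕ → Ω → Fin (N + 1)) (X : ℕ → Fin N → Ω → 𝒳) : Prop where
  measurable_T : Measurable T
  measurable_M : ∀ k, Measurable (M k)
  measurable_X : ∀ b i, Measurable (X b i)
  law_T_zero : μ.real {ω | T ω = 0} = ρ
  law_T_pos : ∀ k, 1 ≤ k → μ.real {ω | T ω = k} = (1 - ρ) * (p * (1 - p) ^ (k - 1))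
  law_M : ∀ (k : ℕ) (o : ℕ → Fin (N + 1)),
    μ.real {ω | ∀ l, l < k + 1 → M l ω = o l} =
      μ.real {ω | ∀ l, l < k → M l ω = o l} * outcomeProb σ (netState m o k) (o k)
  law_X : ∀ (t n : ℕ) (A : ℕ → Fin N → Set 𝒳), (∀ b i, MeasurableSet (A b i)) →
    μ.real {ω | T ω = t ∧ ∀ b ∈ Finset.Icc 1 n, ∀ i, X b i ω ∈ A b i} =
      μ.real {ω | T ω = t} *
        ∏ b ∈ Finset.Icc 1 n, ∏ i, (if t ≤ b * m then F₁ else F₀).real (A b i)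
  indep : IndepFun (fun ω k => M k ω) (fun ω => (T ω, fun (b : ℕ) (i : Fin N) => X (b + 1) i ω)) μ

/-- The network state `Q k` as a random variable. -/
noncomputable def Q (m : ℕ) (M : ℕ → Ω → Fin (N + 1)) (k : ℕ) (ω : Ω) : QueueState N :=
  queueState m (fun l => M l ω) k

/-- The samples received by the decision maker at time `k`; the entry of node `i` is `Sum.inr ()`
if no sample of node `i` is received. -/
noncomputable def Y (m : ℕ) (M : ℕ → Ω → Fin (N + 1)) (X : ℕ → Fin N → Ω → 𝒳) :
    ℕ → Ω → Fin N → 𝒳 ⊕ Unit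
  | 0 => fun _ _ => Sum.inr ()
  | k + 1 => fun ω i =>
      match delivered (netState m (fun l => M l ω) k) (M k ω) i with
      | none => Sum.inr ()
      | some b => Sum.inl (X b i ω)

/-- The observation `Z k = [Q k, Y k]`. -/
noncomputable def Z (m : ℕ) (M : ℕ → Ω → Fin (N + 1)) (X : ℕ → Fin N → Ω → 𝒳) (k : ℕ) (ω : Ω) :
    QueueState N × (Fin N → 𝒳 ⊕ Unit) :=
  (Q m M k ω, Y m M X k ω)

instance : Countable (NetState N) :=
  Function.Injective.countable (f := fun s : NetState N => (s.B, s.L, s.W, s.R)) (by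
    intro s t h
    simp only [Prod.mk.injEq] at h
    exact NetState.ext h.1 h.2.1 h.2.2.1 h.2.2.2)

instance : DiscreteMeasurableSpace (NetState N) := ⟨fun _ => trivial⟩

theorem measurable_netState {m : ℕ} {M : ℕ → Ω → Fin (N + 1)} (hM : ∀ k, Measurable (M k)) (k : ℕ) :
    Measurable (fun ω => netState m (fun l => M l ω) k) := by
  induction k with
  | zero => exact measurable_const
  | succ k ih =>
    exact (measurable_of_countable
      (fun x : NetState N × Fin (N + 1) => netStep m k x.1 x.2)).comp (ih.prodMk (hM k))

theorem measurable_Z {m : ℕ} {M : ℕ → Ω → Fin (N + 1)} {X : ℕ → Fin N → Ω → 𝒳}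
    (hM : ∀ k, Measurable (M k)) (hX : ∀ b i, Measurable (X b i)) (k : ℕ) :
    Measurable (Z m M X k) := by
  refine Measurable.prodMk ?_ ?_
  · exact (measurable_of_countable (fun s : NetState N =>
      (⟨slotsToGo m k, s.B, k - s.B * m, s.W, s.R⟩ : QueueState N))).comp (measurable_netState hM k)
  · cases k with
    | zero => exact measurable_const
    | succ k =>
      refine measurable_pi_lambda _ fun i => ?_
      intro A hA
      have hd : ∀ d : NetState N × Fin (N + 1),
          MeasurableSet {ω | (netState m (fun l => M l ω) k, M k ω) = d} := fun d =>
        ((measurable_netState hM k).prodMk (hM k)) (measurableSet_singleton d)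
      have : (fun ω => Y m M X (k + 1) ω i) ⁻¹' A =
          ⋃ d : NetState N × Fin (N + 1),
            {ω | (netState m (fun l => M l ω) k, M k ω) = d} ∩
            {ω | (match delivered d.1 d.2 i with
              | none => Sum.inr ()
              | some b => Sum.inl (X b i ω) : 𝒳 ⊕ Unit) ∈ A} := by
        ext ω
        simp [Y]
      rw [this]
      refine MeasurableSet.iUnion fun d => (hd d).inter ?_
      cases delivered d.1 d.2 i with
      | none => exact (measurable_const (a := (Sum.inr () : 𝒳 ⊕ Unit))) hA
      | some b => exact (measurable_inl.comp (hX b i)) hA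

/-- The information available to the decision maker: the σ-algebra at time `k` is generated by
the observations `Z 0, …, Z k`. -/
noncomputable def information {m : ℕ} {M : ℕ → Ω → Fin (N + 1)} {X : ℕ → Fin N → Ω → 𝒳}
    (hM : ∀ k, Measurable (M k)) (hX : ∀ b i, Measurable (X b i)) :
    Filtration ℕ (inferInstance : MeasurableSpace Ω) where
  seq k := ⨆ l ≤ k, MeasurableSpace.comap (Z m M X l) inferInstance
  mono' := fun _ _ h => biSup_mono fun _ hl => hl.trans h
  le' := fun _ => iSup₂_le fun l _ => (measurable_Z hM hX l).comap_le

/-- The posterior probability at time `k` that the change has occurred, `P(T ≤ k | ℱ k)`. -/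
noncomputable def posterior (μ : Measure Ω) (T : Ω → ℕ)
    (ℱ : Filtration ℕ (inferInstance : MeasurableSpace Ω))
    (k : ℕ) : Ω → ℝ :=
  μ⟦{ω | T ω ≤ k} | ℱ k⟧

/-- The Bayesian risk `P(τ < T) + c * E[(τ - T)⁺]` of a decision time `τ` (`⊤`: never stop).
The subtraction in `ℕ∞` is truncated at `0`. -/
noncomputable def risk (c : ℝ) (μ : Measure Ω) (T : Ω → ℕ) (τ : Ω → ℕ∞) : ℝ≥0∞ :=
  μ {ω | τ ω < (T ω : ℕ∞)} + ENNReal.ofReal c * ∫⁻ ω, ((τ ω - (T ω : ℕ∞) : ℕ∞) : ℝ≥0∞) ∂μ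

/-- The threshold rule `inf {k ≥ 0 : P k ≥ γ (q k)}` (`⊤` if there is no such `k`). -/
noncomputable def thresholdRule (γ : QueueState N → ℝ) (P : ℕ → Ω → ℝ) (q : ℕ → Ω → QueueState N)
    (ω : Ω) : ℕ∞ :=
  sInf {n : ℕ∞ | ∃ k : ℕ, n = k ∧ γ (q k ω) ≤ P k ω}

end Model

end NADM

/-
The conditional law of the change time `T` given the observations is a sufficient statistic, so
value iteration over posterior laws solves the stopping problem: it is optimal to stop exactly when
stopping at once beats every continuation with a bounded horizon. Two facts reduce this criterion
to a threshold on `P(T ≤ k | ℱ k)` which depends on time and network state only. The current batch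
`B` is sampled at time `B * m`, so changes up to time `min k (B * m)` look alike to all future
observations and losses. Later changes have not influenced any sample handed over so far, so their
posterior weights are still proportional to the geometric prior. Hence only the odds of a change
matter, and the gain from stopping is monotone in them. Finally the observed queueing state
determines the time and the whole network state, except that the initial queueing state is also
shown at time `m` if nothing has been received by then.
-/

namespace NADM

section OptimalStopping

open Filter Topology

variable {Ω : Type*} {mΩ : MeasurableSpace Ω} {μ : Measure Ω} {ℱ : Filtration ℕ mΩ}
  {g r : ℕ → Ω → ℝ≥0∞} {V C : ℕ → ℕ → Ω → ℝ≥0∞} {τ τ' : Ω → ℕ∞}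

/-- The expected cost incurred at time `k` under the stopping rule `τ`: the stopping cost `g` if
`τ = k`, the running cost `r` if `k < τ`. -/
noncomputable def stageCost (μ : Measure Ω) (g r : ℕ → Ω → ℝ≥0∞) (τ : Ω → ℕ∞) (k : ℕ) : ℝ≥0∞ :=
  ∫⁻ ω in {ω | τ ω = k}, g k ω ∂μ + ∫⁻ ω in {ω | k < τ ω}, r k ω ∂μ

/-- The expected cost of the stopping rule `τ`. Where `τ = ⊤` no stopping cost is ever paid. -/
noncomputable def expectedCost (μ : Measure Ω) (g r : ℕ → Ω → ℝ≥0∞) (τ : Ω → ℕ∞) : ℝ≥0∞ :=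
  ∑' k, stageCost μ g r τ k

/-- Value iteration for the stopping problem with stopping cost `g` and running cost `r`: `V n k`
is the least conditional cost from time `k` on if the process must be stopped by time `k + n`, and
`C n k` is the conditional cost of continuing at time `k` when `n` further periods remain after
the next observation. -/
structure IsValueIteration (ℱ : Filtration ℕ mΩ) (μ : Measure Ω) (g r : ℕ → Ω → ℝ≥0∞)
    (V C : ℕ → ℕ → Ω → ℝ≥0∞) : Prop where
  measurable_cont : ∀ n k, Measurable (C n k)
  value_zero : ∀ k, V 0 k = g k
  value_succ : ∀ n k ω, V (n + 1) k ω = min (g k ω) (C n k ω)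
  setLIntegral_cont : ∀ n k A, MeasurableSet[ℱ k] A →
    ∫⁻ ω in A, C n k ω ∂μ = ∫⁻ ω in A, r k ω ∂μ + ∫⁻ ω in A, V n (k + 1) ω ∂μ
  antitone_cont : ∀ k ω, Antitone fun n => C n k ω

theorem measurableSet_eq_natCast (hτ : IsStoppingTime ℱ τ) (k : ℕ) :
    MeasurableSet[ℱ k] {ω | τ ω = k} :=
  hτ.measurableSet_eq k

theorem measurableSet_natCast_lt (hτ : IsStoppingTime ℱ τ) (k : ℕ) :
    MeasurableSet[ℱ k] {ω | k < τ ω} :=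
  hτ.measurableSet_gt k

theorem setLIntegral_le_eq_add_lt (hτ : IsStoppingTime ℱ τ) (k : ℕ) (f : Ω → ℝ≥0∞) :
    ∫⁻ ω in {ω | k ≤ τ ω}, f ω ∂μ =
      ∫⁻ ω in {ω | τ ω = k}, f ω ∂μ + ∫⁻ ω in {ω | k < τ ω}, f ω ∂μ := by
  have hsplit : {ω | k ≤ τ ω} = {ω | τ ω = k} ∪ {ω | k < τ ω} := by
    ext ω
    simp only [Set.mem_ofPred_eq, Set.mem_union, le_iff_eq_or_lt, eq_comm]
  rw [hsplit, lintegral_union (ℱ.le k _ (measurableSet_natCast_lt hτ k))]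
  exact Set.disjoint_left.2 fun ω h h' => h'.ne' h

theorem setOf_succ_le (τ : Ω → ℕ∞) (k : ℕ) :
    {ω | ((k + 1 : ℕ) : ℕ∞) ≤ τ ω} = {ω | k < τ ω} := by
  ext ω
  simp [ENat.add_one_le_iff]

namespace IsValueIteration

theorem value_le_stoppingCost (h : IsValueIteration ℱ μ g r V C) (n k : ℕ) (ω : Ω) :
    V n k ω ≤ g k ω := by
  cases n with
  | zero => rw [h.value_zero]
  | succ n => exact (h.value_succ n k ω).trans_le (min_le_left _ _)

theorem setLIntegral_value_le (h : IsValueIteration ℱ μ g r V C) (hτ : IsStoppingTime ℱ τ)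
    (n j : ℕ) :
    ∫⁻ ω in {ω | j ≤ τ ω}, V n j ω ∂μ ≤
      ∑ i ∈ Finset.range n, stageCost μ g r τ (j + i) +
        ∫⁻ ω in {ω | (j + n : ℕ) ≤ τ ω}, g (j + n) ω ∂μ := by
  induction n generalizing j with
  | zero => simp [h.value_zero]
  | succ n ih =>
    have h_stopping : ∫⁻ ω in {ω | τ ω = j}, V (n + 1) j ω ∂μ ≤ ∫⁻ ω in {ω | τ ω = j}, g j ω ∂μ :=
      lintegral_mono (h.value_le_stoppingCost (n + 1) j)
    have hcont : ∫⁻ ω in {ω | j < τ ω}, V (n + 1) j ω ∂μ ≤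
        ∫⁻ ω in {ω | j < τ ω}, r j ω ∂μ + ∫⁻ ω in {ω | j < τ ω}, V n (j + 1) ω ∂μ := by
      rw [← h.setLIntegral_cont n j _ (measurableSet_natCast_lt hτ j)]
      exact lintegral_mono fun ω => (h.value_succ n j ω).trans_le (min_le_right _ _)
    specialize ih (j + 1)
    rw [setOf_succ_le] at ih
    rw [setLIntegral_le_eq_add_lt hτ, Finset.sum_range_succ', add_zero]
    simp only [add_assoc, add_comm 1] at ih ⊢
    calc _ ≤ ∫⁻ ω in {ω | τ ω = j}, g j ω ∂μ + (∫⁻ ω in {ω | j < τ ω}, r j ω ∂μ +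
          ∫⁻ ω in {ω | j < τ ω}, V n (j + 1) ω ∂μ) := add_le_add h_stopping hcont
      _ = stageCost μ g r τ j + ∫⁻ ω in {ω | j < τ ω}, V n (j + 1) ω ∂μ := by
        rw [stageCost, add_assoc]
      _ ≤ _ := add_le_add le_rfl ih
      _ = _ := by abel

theorem lintegral_iInf_value_le_expectedCost (h : IsValueIteration ℱ μ g r V C)
    (hlim : Tendsto (fun k => ∫⁻ ω, g k ω ∂μ) atTop (𝓝 0)) (hτ : IsStoppingTime ℱ τ) :
    ∫⁻ ω, ⨅ n, V n 0 ω ∂μ ≤ expectedCost μ g r τ := by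
  have hbound (n : ℕ) :
      ∫⁻ ω, ⨅ n, V n 0 ω ∂μ ≤ expectedCost μ g r τ + ∫⁻ ω, g n ω ∂μ := by
    calc ∫⁻ ω, ⨅ n, V n 0 ω ∂μ ≤ ∫⁻ ω, V n 0 ω ∂μ := lintegral_mono fun ω => iInf_le _ n
      _ ≤ ∑ i ∈ Finset.range n, stageCost μ g r τ i + ∫⁻ ω in {ω | (n : ℕ) ≤ τ ω}, g n ω ∂μ := by
        simpa using h.setLIntegral_value_le hτ n 0
      _ ≤ expectedCost μ g r τ + ∫⁻ ω, g n ω ∂μ :=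
        add_le_add (ENNReal.sum_le_tsum _) (setLIntegral_le_lintegral _ _)
  simpa using ge_of_tendsto' (tendsto_const_nhds.add hlim) hbound

theorem setLIntegral_iInf_cont_ge (h : IsValueIteration ℱ μ g r V C)
    (hg : ∀ k, ∫⁻ ω, g k ω ∂μ ≠ ∞) (hr : ∀ k, ∫⁻ ω, r k ω ∂μ ≠ ∞) {k : ℕ} {A : Set Ω}
    (hA : MeasurableSet[ℱ k] A) :
    ∫⁻ ω in A, r k ω ∂μ + ∫⁻ ω in A, ⨅ n, V n (k + 1) ω ∂μ ≤
      ∫⁻ ω in A, ⨅ n, C n k ω ∂μ := by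
  have hfin : ∫⁻ ω in A, C 0 k ω ∂μ ≠ ∞ := by
    rw [h.setLIntegral_cont 0 k A hA, h.value_zero]
    exact ENNReal.add_ne_top.2 ⟨ne_top_of_le_ne_top (hr k) (setLIntegral_le_lintegral _ _),
      ne_top_of_le_ne_top (hg _) (setLIntegral_le_lintegral _ _)⟩
  rw [lintegral_iInf (fun n => h.measurable_cont n k)
    (fun _ _ hn ω => h.antitone_cont k ω hn) hfin]
  refine le_iInf fun n => ?_
  rw [h.setLIntegral_cont n k A hA]
  gcongr
  exact iInf_le _ n

theorem iInf_value_eq_min (h : IsValueIteration ℱ μ g r V C) (k : ℕ) (ω : Ω) :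
    ⨅ n, V n k ω = min (g k ω) (⨅ n, C n k ω) := by
  refine le_antisymm (le_min ((iInf_le _ 0).trans (h.value_le_stoppingCost 0 k ω)) (le_iInf fun n =>
    (iInf_le _ (n + 1)).trans ((h.value_succ n k ω).trans_le (min_le_right _ _))))
    (le_iInf fun n => ?_)
  cases n with
  | zero => exact (min_le_left _ _).trans_eq (congrFun (h.value_zero k).symm ω)
  | succ n =>
    rw [h.value_succ]
    exact min_le_min le_rfl (iInf_le _ n)

theorem sum_stageCost_add_le (h : IsValueIteration ℱ μ g r V C)
    (hg : ∀ k, ∫⁻ ω, g k ω ∂μ ≠ ∞) (hr : ∀ k, ∫⁻ ω, r k ω ∂μ ≠ ∞) (hτ : IsStoppingTime ℱ τ)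
    (hopt : ∀ᵐ ω ∂μ, ∀ k : ℕ, k ≤ τ ω → (τ ω = k ↔ ∀ n, g k ω ≤ C n k ω)) (k : ℕ) :
    ∑ i ∈ Finset.range k, stageCost μ g r τ i + ∫⁻ ω in {ω | k ≤ τ ω}, ⨅ n, V n k ω ∂μ ≤
      ∫⁻ ω, ⨅ n, V n 0 ω ∂μ := by
  induction k with
  | zero => simp
  | succ k ih =>
    refine le_trans ?_ ih
    have h_stopping : ∫⁻ ω in {ω | τ ω = k}, ⨅ n, V n k ω ∂μ = ∫⁻ ω in {ω | τ ω = k}, g k ω ∂μ := by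
      refine setLIntegral_congr_fun_ae (ℱ.le k _ (measurableSet_eq_natCast hτ k)) ?_
      filter_upwards [hopt] with ω hω hk
      rw [h.iInf_value_eq_min, min_eq_left (le_iInf ((hω k (ge_of_eq hk)).1 hk))]
    have hcont : ∫⁻ ω in {ω | k < τ ω}, ⨅ n, V n k ω ∂μ =
        ∫⁻ ω in {ω | k < τ ω}, ⨅ n, C n k ω ∂μ := by
      refine setLIntegral_congr_fun_ae (ℱ.le k _ (measurableSet_natCast_lt hτ k)) ?_
      filter_upwards [hopt] with ω hω (hk : (k : ℕ∞) < τ ω)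
      obtain ⟨n, hn⟩ := not_forall.1 (mt (hω k hk.le).2 hk.ne')
      rw [h.iInf_value_eq_min, min_eq_right ((iInf_le _ n).trans (not_le.1 hn).le)]
    rw [setLIntegral_le_eq_add_lt hτ k, h_stopping, hcont, Finset.sum_range_succ, setOf_succ_le,
      add_assoc, stageCost, add_assoc]
    gcongr
    exact h.setLIntegral_iInf_cont_ge hg hr (measurableSet_natCast_lt hτ k)

theorem expectedCost_le_expectedCost (h : IsValueIteration ℱ μ g r V C)
    (hg : ∀ k, ∫⁻ ω, g k ω ∂μ ≠ ∞) (hr : ∀ k, ∫⁻ ω, r k ω ∂μ ≠ ∞)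
    (hlim : Tendsto (fun k => ∫⁻ ω, g k ω ∂μ) atTop (𝓝 0)) (hτ : IsStoppingTime ℱ τ)
    (hopt : ∀ᵐ ω ∂μ, ∀ k : ℕ, k ≤ τ ω → (τ ω = k ↔ ∀ n, g k ω ≤ C n k ω))
    (hτ' : IsStoppingTime ℱ τ') :
    expectedCost μ g r τ ≤ expectedCost μ g r τ' :=
  (ENNReal.tsum_le_of_sum_range_le fun k =>
    le_self_add.trans (h.sum_stageCost_add_le hg hr hτ hopt k)).trans
    (h.lintegral_iInf_value_le_expectedCost hlim hτ')

end IsValueIteration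

end OptimalStopping

section BayesStopping

/-- The total loss `u` under the (unnormalized) law `f` of the parameter. -/
noncomputable def totalLoss {Θ : Type*} (f u : Θ → ℝ≥0∞) : ℝ≥0∞ := ∑' θ, f θ * u θ

/-- Two weights on `Θ` which become equal when the points of `A` are merged into one. -/
structure MergeEq {Θ : Type*} (A : Set Θ) (f g : Θ → ℝ≥0∞) : Prop where
  eq_off : ∀ θ ∉ A, f θ = g θ
  tsum_eq : ∑' θ : A, f θ = ∑' θ : A, g θ

section TotalLoss

variable {Θ : Type*} {f g u : Θ → ℝ≥0∞} {a : ℝ≥0∞}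

theorem measurable_totalLoss [Countable Θ] (u : Θ → ℝ≥0∞) : Measurable fun f => totalLoss f u :=
  Measurable.tsum fun θ => (measurable_pi_apply θ).mul_const _

theorem totalLoss_smul (a : ℝ≥0∞) (f u : Θ → ℝ≥0∞) :
    totalLoss (a • f) u = a * totalLoss f u := by
  simp only [totalLoss, Pi.smul_apply, smul_eq_mul, mul_assoc, ENNReal.tsum_mul_left]

theorem totalLoss_add (f g u : Θ → ℝ≥0∞) :
    totalLoss (f + g) u = totalLoss f u + totalLoss g u := by
  simp only [totalLoss, Pi.add_apply, add_mul, ENNReal.tsum_add]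

theorem totalLoss_mono (h : f ≤ g) (u : Θ → ℝ≥0∞) : totalLoss f u ≤ totalLoss g u :=
  ENNReal.tsum_le_tsum fun θ => mul_le_mul_left (h θ) _

theorem totalLoss_le (hu : ∀ θ, u θ ≤ a) (f : Θ → ℝ≥0∞) : totalLoss f u ≤ a * ∑' θ, f θ := by
  rw [← ENNReal.tsum_mul_left]
  exact ENNReal.tsum_le_tsum fun θ => (mul_le_mul_right (hu θ) _).trans_eq (mul_comm _ _)

theorem MergeEq.totalLoss_eq {A : Set Θ} (h : MergeEq A f g)
    (hu : ∀ θ ∈ A, ∀ θ' ∈ A, u θ = u θ') : totalLoss f u = totalLoss g u := by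
  have hsplit (f : Θ → ℝ≥0∞) :
      totalLoss f u = ∑' θ : A, f θ * u θ + ∑' θ : (Aᶜ : Set Θ), f θ * u θ :=
    (ENNReal.summable.tsum_add_tsum_compl ENNReal.summable).symm
  rw [hsplit f, hsplit g]
  congr 1
  · rcases A.eq_empty_or_nonempty with rfl | ⟨θ₀, hθ₀⟩
    · simp
    · simp only [fun θ : A => hu θ θ.2 θ₀ hθ₀, ENNReal.tsum_mul_right, h.tsum_eq]
  · exact tsum_congr fun θ => by rw [h.eq_off θ θ.2]

theorem totalLoss_Iic_eq_one_sub {f : ℕ → ℝ≥0∞} (hf : ∑' t, f t = 1) (k : ℕ) :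
    totalLoss f ((Set.Iic k).indicator 1) = 1 - ∑' t : Set.Ioi k, f t := by
  have hadd : ∑' t : Set.Ioi k, f t + totalLoss f ((Set.Iic k).indicator 1) = 1 := by
    rw [tsum_subtype _ f, totalLoss, ← ENNReal.tsum_add, ← hf]
    refine tsum_congr fun t => ?_
    rcases le_or_gt t k with ht | ht
    · simp [ht]
    · simp [ht, ht.not_ge]
  rw [← hadd, ENNReal.add_sub_cancel_left (ne_top_of_le_ne_top ENNReal.one_ne_top
    (hadd ▸ le_self_add))]

end TotalLoss

/-- A stopping problem with an unknown parameter `θ`. In state `s` the next observation has law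
`obsLaw s θ`, and the observation `z` moves the state to `next s z`; stopping in state `s` costs
`stopLoss s θ`, and running on for one more period costs `runLoss s θ`. -/
structure BayesStopping (Θ S O : Type*) [MeasurableSpace S] [MeasurableSpace O] where
  obsLaw : S → Θ → Measure O
  isProbabilityMeasure_obsLaw : ∀ s θ, IsProbabilityMeasure (obsLaw s θ)
  next : S → O → S
  measurable_next : ∀ s, Measurable (next s)
  stopLoss : S → Θ → ℝ≥0∞
  runLoss : S → Θ → ℝ≥0∞

namespace BayesStopping

attribute [instance] isProbabilityMeasure_obsLaw

variable {Θ S O : Type*} [MeasurableSpace S] [MeasurableSpace O] [Countable Θ]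
  (P : BayesStopping Θ S O)

/-- A finite measure dominating the observation laws in state `s` for all parameters. -/
noncomputable def dominating (s : S) : Measure O := (Measure.sum (P.obsLaw s)).toFinite

instance (s : S) : IsFiniteMeasure (P.dominating s) := by
  unfold dominating
  infer_instance

/-- The likelihood of an observation in state `s`. -/
noncomputable def density (s : S) (θ : Θ) : O → ℝ≥0∞ := (P.obsLaw s θ).rnDeriv (P.dominating s)

/-- Bayes' rule without the normalization: the law `f` of the parameter becomes
`reweight s z f` after observing `z` in state `s`. -/
noncomputable def reweight (s : S) (z : O) (f : Θ → ℝ≥0∞) (θ : Θ) : ℝ≥0∞ := f θ * P.density s θ z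

/-- The least expected cost from state `s` on, when the parameter has the (unnormalized) law `f`
and at most `n` further observations are allowed. -/
noncomputable def value : ℕ → S → (Θ → ℝ≥0∞) → ℝ≥0∞
  | 0, s, f => totalLoss f (P.stopLoss s)
  | n + 1, s, f => min (totalLoss f (P.stopLoss s))
      (totalLoss f (P.runLoss s) +
        ∫⁻ z, value n (P.next s z) (P.reweight s z f) ∂P.dominating s)

/-- The least expected cost when at least one and at most `n + 1` observations have to be taken. -/
noncomputable def contCost (n : ℕ) (s : S) (f : Θ → ℝ≥0∞) : ℝ≥0∞ :=
  totalLoss f (P.runLoss s) + ∫⁻ z, P.value n (P.next s z) (P.reweight s z f) ∂P.dominating s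

/-- Stopping at once is at least as good as any continuation with a bounded horizon. -/
def StopOptimal (s : S) (f : Θ → ℝ≥0∞) : Prop :=
  ∀ n, totalLoss f (P.stopLoss s) ≤ P.contCost n s f

theorem value_succ (n : ℕ) (s : S) (f : Θ → ℝ≥0∞) :
    P.value (n + 1) s f = min (totalLoss f (P.stopLoss s)) (P.contCost n s f) := rfl

theorem obsLaw_absolutelyContinuous_dominating (s : S) (θ : Θ) :
    P.obsLaw s θ ≪ P.dominating s :=
  (Measure.absolutelyContinuous_sum_right θ .rfl).trans (absolutelyContinuous_toFinite _)

theorem measurable_density (s : S) (θ : Θ) : Measurable (P.density s θ) :=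
  Measure.measurable_rnDeriv _ _

theorem setLIntegral_density (s : S) (θ : Θ) (C : Set O) :
    ∫⁻ z in C, P.density s θ z ∂P.dominating s = P.obsLaw s θ C :=
  Measure.setLIntegral_rnDeriv (P.obsLaw_absolutelyContinuous_dominating s θ) C

theorem measurable_reweight (s : S) :
    Measurable fun x : (Θ → ℝ≥0∞) × O => P.reweight s x.2 x.1 :=
  measurable_pi_lambda _ fun θ => ((measurable_pi_apply θ).comp measurable_fst).mul
    ((P.measurable_density s θ).comp measurable_snd)

theorem reweight_smul (a : ℝ≥0∞) (s : S) (z : O) (f : Θ → ℝ≥0∞) :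
    P.reweight s z (a • f) = a • P.reweight s z f :=
  funext fun _ => mul_assoc _ _ _

theorem reweight_add (s : S) (z : O) (f g : Θ → ℝ≥0∞) :
    P.reweight s z (f + g) = P.reweight s z f + P.reweight s z g :=
  funext fun _ => add_mul _ _ _

theorem reweight_mono (s : S) (z : O) : Monotone (P.reweight s z) := fun _ _ h θ =>
  mul_le_mul_left (h θ) _

theorem measurable_tsum_reweight (s : S) (f : Θ → ℝ≥0∞) :
    Measurable fun z => ∑' θ, P.reweight s z f θ :=
  Measurable.tsum fun θ => (P.measurable_density s θ).const_mul _

theorem lintegral_tsum_reweight (s : S) (f : Θ → ℝ≥0∞) :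
    ∫⁻ z, ∑' θ, P.reweight s z f θ ∂P.dominating s = ∑' θ, f θ := by
  simp only [reweight]
  rw [lintegral_tsum fun θ => ((P.measurable_density s θ).const_mul _).aemeasurable]
  refine tsum_congr fun θ => ?_
  rw [lintegral_const_mul _ (P.measurable_density s θ), ← setLIntegral_univ,
    P.setLIntegral_density, measure_univ, mul_one]

theorem value_mono (n : ℕ) (s : S) : Monotone (P.value n s) := by
  induction n generalizing s with
  | zero => exact fun f g h => totalLoss_mono h _
  | succ n ih =>
    exact fun f g h => min_le_min (totalLoss_mono h _) (add_le_add (totalLoss_mono h _)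
      (lintegral_mono fun z => ih _ (P.reweight_mono s z h)))

theorem contCost_mono (n : ℕ) (s : S) : Monotone (P.contCost n s) := fun _ _ h =>
  add_le_add (totalLoss_mono h _)
    (lintegral_mono fun z => P.value_mono n _ (P.reweight_mono s z h))

theorem value_succ_le (n : ℕ) (s : S) (f : Θ → ℝ≥0∞) : P.value (n + 1) s f ≤ P.value n s f := by
  induction n generalizing s f with
  | zero => exact min_le_left _ _
  | succ n ih => exact min_le_min le_rfl (add_le_add le_rfl (lintegral_mono fun z => ih _ _))

theorem antitone_contCost (s : S) (f : Θ → ℝ≥0∞) : Antitone fun n => P.contCost n s f :=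
  antitone_nat_of_succ_le fun n => add_le_add le_rfl (lintegral_mono fun _ => P.value_succ_le n _ _)

/-- The parameters in `E s` cannot be told apart, by observations or by losses, from state `s`
on. -/
structure IsIndistinguishable (E : S → Set Θ) : Prop where
  subset_next : ∀ s z, E s ⊆ E (P.next s z)
  obsLaw_eq : ∀ s, ∀ θ ∈ E s, ∀ θ' ∈ E s, P.obsLaw s θ = P.obsLaw s θ'
  stopLoss_eq : ∀ s, ∀ θ ∈ E s, ∀ θ' ∈ E s, P.stopLoss s θ = P.stopLoss s θ'
  runLoss_eq : ∀ s, ∀ θ ∈ E s, ∀ θ' ∈ E s, P.runLoss s θ = P.runLoss s θ'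

namespace IsIndistinguishable

variable {P} {E : S → Set Θ} {s : S} {f g : Θ → ℝ≥0∞}

theorem mergeEq_reweight (hE : P.IsIndistinguishable E) (h : MergeEq (E s) f g) (z : O) :
    MergeEq (E (P.next s z)) (P.reweight s z f) (P.reweight s z g) where
  eq_off θ hθ := by
    rw [reweight, reweight, h.eq_off θ fun hs => hθ (hE.subset_next s z hs)]
  tsum_eq := by
    have hind (f : Θ → ℝ≥0∞) : ∑' θ : E (P.next s z), P.reweight s z f θ =
        totalLoss f ((E (P.next s z)).indicator fun θ => P.density s θ z) := by
      rw [tsum_subtype _ (P.reweight s z f)]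
      exact tsum_congr fun θ => Set.indicator_mul_right _ f _
    rw [hind, hind]
    refine h.totalLoss_eq fun θ hθ θ' hθ' => ?_
    rw [Set.indicator_of_mem (hE.subset_next s z hθ), Set.indicator_of_mem (hE.subset_next s z hθ'),
      density, density, hE.obsLaw_eq s θ hθ θ' hθ']

theorem value_eq (hE : P.IsIndistinguishable E) (n : ℕ) (h : MergeEq (E s) f g) :
    P.value n s f = P.value n s g := by
  induction n generalizing s f g with
  | zero => exact h.totalLoss_eq (hE.stopLoss_eq s)
  | succ n ih =>
    simp only [value, h.totalLoss_eq (hE.stopLoss_eq s), h.totalLoss_eq (hE.runLoss_eq s),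
      ih (hE.mergeEq_reweight h _)]

theorem stopOptimal_iff (hE : P.IsIndistinguishable E) (h : MergeEq (E s) f g) :
    P.StopOptimal s f ↔ P.StopOptimal s g := by
  simp only [StopOptimal, contCost, h.totalLoss_eq (hE.stopLoss_eq s),
    h.totalLoss_eq (hE.runLoss_eq s), hE.value_eq _ (hE.mergeEq_reweight h _)]

end IsIndistinguishable

variable [Countable S] [DiscreteMeasurableSpace S]

theorem measurable_value (n : ℕ) (s : S) : Measurable (P.value n s) := by
  induction n generalizing s with
  | zero => exact measurable_totalLoss _
  | succ n ih =>
    have hn : Measurable fun x : S × (Θ → ℝ≥0∞) => P.value n x.1 x.2 :=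
      measurable_from_prod_countable_right ih
    exact (measurable_totalLoss _).min ((measurable_totalLoss _).add
      (hn.comp (((P.measurable_next s).comp measurable_snd).prodMk
        (P.measurable_reweight s))).lintegral_prod_right')

theorem measurable_value_next (n : ℕ) (s : S) :
    Measurable fun x : (Θ → ℝ≥0∞) × O => P.value n (P.next s x.2) (P.reweight s x.2 x.1) :=
  (measurable_from_prod_countable_right (f := fun x : S × (Θ → ℝ≥0∞) => P.value n x.1 x.2)
    (P.measurable_value n)).comp
    (((P.measurable_next s).comp measurable_snd).prodMk (P.measurable_reweight s))

theorem measurable_contCost (n : ℕ) (s : S) : Measurable (P.contCost n s) :=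
  (measurable_totalLoss _).add (P.measurable_value_next n s).lintegral_prod_right'

theorem measurable_value_next_apply (n : ℕ) (s : S) (f : Θ → ℝ≥0∞) :
    Measurable fun z => P.value n (P.next s z) (P.reweight s z f) :=
  (P.measurable_value_next n s).comp measurable_prodMk_left

theorem value_smul (a : ℝ≥0∞) (n : ℕ) (s : S) (f : Θ → ℝ≥0∞) :
    P.value n s (a • f) = a * P.value n s f := by
  induction n generalizing s f with
  | zero => exact totalLoss_smul a f _
  | succ n ih =>
    simp only [value, totalLoss_smul, reweight_smul, ih]
    rw [lintegral_const_mul _ (P.measurable_value_next_apply n s f), ← mul_add, mul_min]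

theorem contCost_smul (a : ℝ≥0∞) (n : ℕ) (s : S) (f : Θ → ℝ≥0∞) :
    P.contCost n s (a • f) = a * P.contCost n s f := by
  simp only [contCost, totalLoss_smul, reweight_smul, value_smul]
  rw [lintegral_const_mul _ (P.measurable_value_next_apply n s f), mul_add]

theorem stopOptimal_smul_iff {a : ℝ≥0∞} (ha0 : a ≠ 0) (ha : a ≠ ∞) (s : S) (f : Θ → ℝ≥0∞) :
    P.StopOptimal s (a • f) ↔ P.StopOptimal s f := by
  simp only [StopOptimal, totalLoss_smul, contCost_smul, ENNReal.mul_le_mul_iff_right ha0 ha]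

variable {P} {a b : ℝ≥0∞}

theorem contCost_add_le_of_value_add_le (hb : ∀ s θ, P.runLoss s θ ≤ b) {n : ℕ} {K : ℝ≥0∞}
    (hK : ∀ s f v, P.value n s (f + v) ≤ P.value n s f + K * ∑' θ, v θ)
    (s : S) (f v : Θ → ℝ≥0∞) :
    P.contCost n s (f + v) ≤ P.contCost n s f + (K + b) * ∑' θ, v θ := by
  have hint : ∫⁻ z, P.value n (P.next s z) (P.reweight s z (f + v)) ∂P.dominating s ≤
      ∫⁻ z, P.value n (P.next s z) (P.reweight s z f) ∂P.dominating s + K * ∑' θ, v θ := by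
    rw [← P.lintegral_tsum_reweight s v, ← lintegral_const_mul _ (P.measurable_tsum_reweight s v),
      ← lintegral_add_left (P.measurable_value_next_apply n s f)]
    exact lintegral_mono fun z => by simpa only [reweight_add] using hK _ _ _
  calc P.contCost n s (f + v)
      ≤ totalLoss f (P.runLoss s) + b * ∑' θ, v θ +
        (∫⁻ z, P.value n (P.next s z) (P.reweight s z f) ∂P.dominating s + K * ∑' θ, v θ) := by
        rw [contCost, totalLoss_add]
        gcongr
        exact totalLoss_le (hb s) v
    _ = P.contCost n s f + (K + b) * ∑' θ, v θ := by
        rw [contCost]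
        ring

theorem value_add_le (ha : ∀ s θ, P.stopLoss s θ ≤ a) (hb : ∀ s θ, P.runLoss s θ ≤ b)
    (n : ℕ) (s : S) (f v : Θ → ℝ≥0∞) :
    P.value n s (f + v) ≤ P.value n s f + (a + n * b) * ∑' θ, v θ := by
  have h_stopping (n : ℕ) (s : S) (f v : Θ → ℝ≥0∞) : totalLoss (f + v) (P.stopLoss s) ≤
      totalLoss f (P.stopLoss s) + (a + n * b) * ∑' θ, v θ := by
    rw [totalLoss_add]
    gcongr
    exact (totalLoss_le (ha s) v).trans (mul_le_mul_left le_self_add _)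
  induction n generalizing s f v with
  | zero => exact h_stopping 0 s f v
  | succ n ih =>
    have hK : a + (n + 1 : ℕ) * b = a + n * b + b := by
      push_cast
      ring
    rw [value_succ, value_succ, ← min_add_add_right]
    exact min_le_min (h_stopping (n + 1) s f v) (hK ▸ contCost_add_le_of_value_add_le hb ih s f v)

theorem contCost_add_le (ha : ∀ s θ, P.stopLoss s θ ≤ a) (hb : ∀ s θ, P.runLoss s θ ≤ b)
    (n : ℕ) (s : S) (f v : Θ → ℝ≥0∞) :
    P.contCost n s (f + v) ≤ P.contCost n s f + (a + n * b + b) * ∑' θ, v θ :=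
  contCost_add_le_of_value_add_le hb (value_add_le ha hb n) s f v

end BayesStopping

end BayesStopping

section BayesFilter

theorem lintegral_comp_prodMk {Ω E O : Type*} [MeasurableSpace Ω] [MeasurableSpace E]
    [MeasurableSpace O] {ν : Measure Ω} [IsFiniteMeasure ν] {κ : Kernel E O} [IsMarkovKernel κ]
    {e : Ω → E} {o : Ω → O} (he : Measurable e) (ho : Measurable o)
    (h : ∀ A C, MeasurableSet A → MeasurableSet C →
      ν (e ⁻¹' A ∩ o ⁻¹' C) = ∫⁻ ω in e ⁻¹' A, κ (e ω) C ∂ν)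
    {Φ : E × O → ℝ≥0∞} (hΦ : Measurable Φ) :
    ∫⁻ ω, Φ (e ω, o ω) ∂ν = ∫⁻ ω, ∫⁻ z, Φ (e ω, z) ∂κ (e ω) ∂ν := by
  have hlaw : ν.map (fun ω => (e ω, o ω)) = ν.map e ⊗ₘ κ := by
    refine Measure.ext_prod fun {A C} hA hC => ?_
    rw [Measure.map_apply (he.prodMk ho) (hA.prod hC), Measure.compProd_apply_prod hA hC,
      setLIntegral_map hA (κ.measurable_coe hC) he, ← h A C hA hC]
    rfl
  rw [← lintegral_map hΦ (he.prodMk ho), hlaw, Measure.lintegral_compProd hΦ,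
    lintegral_map hΦ.lintegral_kernel_prod_right' he]

theorem measurable_lintegral_of_countable {E S O : Type*} {_ : MeasurableSpace E}
    [MeasurableSpace S] [MeasurableSpace O] [Countable S] [MeasurableSingletonClass S]
    {ν : S → Measure O} [∀ s, SFinite (ν s)] {s : E → S} (hs : Measurable s)
    {Φ : E × O → ℝ≥0∞} (hΦ : Measurable Φ) : Measurable fun x => ∫⁻ z, Φ (x, z) ∂ν (s x) :=
  (measurable_from_prod_countable_right (f := fun y : S × E => ∫⁻ z, Φ (y.2, z) ∂ν y.1)
    fun t => hΦ.lintegral_prod_right' (ν := ν t)).comp (hs.prodMk measurable_id)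

/-- The weights `f` scaled to total mass one; meaningful only if the total mass of `f` is neither
`0` nor `∞`. -/
noncomputable def normalized {Θ : Type*} (f : Θ → ℝ≥0∞) : Θ → ℝ≥0∞ := (∑' θ, f θ)⁻¹ • f

theorem tsum_mul_normalized {Θ : Type*} {f : Θ → ℝ≥0∞} (hf : ∑' θ, f θ ≠ ∞) (θ : Θ) :
    (∑' θ, f θ) * normalized f θ = f θ := by
  by_cases h0 : ∑' θ, f θ = 0
  · rw [h0, zero_mul, ENNReal.tsum_eq_zero.1 h0 θ]
  · rw [normalized, Pi.smul_apply, smul_eq_mul, ← mul_assoc, ENNReal.mul_inv_cancel h0 hf, one_mul]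

theorem measurable_normalized {Θ : Type*} [Countable Θ] :
    Measurable (normalized : (Θ → ℝ≥0∞) → Θ → ℝ≥0∞) :=
  measurable_pi_lambda _ fun θ =>
    (Measurable.tsum fun θ => measurable_pi_apply θ).inv.mul (measurable_pi_apply θ)

variable {Ω Θ : Type*} {m mΩ : MeasurableSpace Ω} {μ : Measure Ω} {T : Ω → Θ}
  {w : Ω → Θ → ℝ≥0∞}

/-- The weights `w` are a version of the conditional law of `T` given `m`. -/
structure IsConditionalLaw (μ : Measure Ω) (T : Ω → Θ) (m : MeasurableSpace Ω)
    (w : Ω → Θ → ℝ≥0∞) : Prop where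
  measurable : Measurable[m] w
  measure_inter : ∀ θ A, MeasurableSet[m] A → μ (T ⁻¹' {θ} ∩ A) = ∫⁻ ω in A, w ω θ ∂μ

namespace IsConditionalLaw

theorem measurable_apply (hw : IsConditionalLaw μ T m w) (θ : Θ) : Measurable[m] fun ω => w ω θ :=
  (measurable_pi_apply θ).comp hw.measurable

theorem restrict (hw : IsConditionalLaw μ T m w) (hm : m ≤ mΩ) {A : Set Ω}
    (hA : MeasurableSet[m] A) : IsConditionalLaw (μ.restrict A) T m w where
  measurable := hw.measurable
  measure_inter θ D hD := by
    rw [Measure.restrict_restrict (hm D hD), Measure.restrict_apply' (hm A hA), Set.inter_assoc]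
    exact hw.measure_inter θ _ (hD.inter hA)

theorem lintegral_fiber (hw : IsConditionalLaw μ T m w) (hm : m ≤ mΩ) (θ : Θ) {ψ : Ω → ℝ≥0∞}
    (hψ : Measurable[m] ψ) : ∫⁻ ω in T ⁻¹' {θ}, ψ ω ∂μ = ∫⁻ ω, w ω θ * ψ ω ∂μ := by
  have hwθ := (hw.measurable_apply θ).mono hm le_rfl
  have htrim : (μ.restrict (T ⁻¹' {θ})).trim hm = (μ.withDensity fun ω => w ω θ).trim hm := by
    refine @Measure.ext _ m _ _ fun A hA => ?_
    rw [trim_measurableSet_eq hm hA, trim_measurableSet_eq hm hA, withDensity_apply _ (hm A hA),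
      ← hw.measure_inter θ A hA, Measure.restrict_apply (hm A hA), Set.inter_comm]
  rw [← lintegral_trim hm hψ, htrim, lintegral_trim hm hψ,
    lintegral_withDensity_eq_lintegral_mul _ hwθ (hψ.mono hm le_rfl)]
  rfl

variable [Countable Θ] [MeasurableSpace Θ] [MeasurableSingletonClass Θ]

theorem lintegral_eq_tsum_fiber (hT : Measurable T) (f : Ω → ℝ≥0∞) :
    ∫⁻ ω, f ω ∂μ = ∑' θ, ∫⁻ ω in T ⁻¹' {θ}, f ω ∂μ := by
  rw [← setLIntegral_univ f, ← Set.preimage_univ (f := T), ← Set.iUnion_of_singleton Θ,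
    Set.preimage_iUnion, lintegral_iUnion (fun θ => hT (measurableSet_singleton θ))
      fun θ θ' h => (Set.disjoint_singleton.2 h).preimage T]

theorem lintegral_totalLoss (hw : IsConditionalLaw μ T m w) (hm : m ≤ mΩ) (hT : Measurable T)
    {u : Ω → Θ → ℝ≥0∞} (hu : Measurable[m] u) :
    ∫⁻ ω, totalLoss (w ω) (u ω) ∂μ = ∫⁻ ω, u ω (T ω) ∂μ := by
  have huθ (θ : Θ) : Measurable[m] fun ω => u ω θ := (measurable_pi_apply θ).comp hu
  rw [lintegral_eq_tsum_fiber hT fun ω => u ω (T ω)]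
  refine (lintegral_tsum fun θ =>
    (((hw.measurable_apply θ).mul (huθ θ)).mono hm le_rfl).aemeasurable).trans ?_
  refine tsum_congr fun θ => ?_
  refine (hw.lintegral_fiber hm θ (huθ θ)).symm.trans ?_
  exact setLIntegral_congr_fun (hT (measurableSet_singleton θ)) fun ω (hω : T ω = θ) => by rw [hω]

theorem setLIntegral_totalLoss (hw : IsConditionalLaw μ T m w) (hm : m ≤ mΩ) (hT : Measurable T)
    {u : Ω → Θ → ℝ≥0∞} (hu : Measurable[m] u) {A : Set Ω} (hA : MeasurableSet[m] A) :
    ∫⁻ ω in A, totalLoss (w ω) (u ω) ∂μ = ∫⁻ ω in A, u ω (T ω) ∂μ :=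
  (hw.restrict hm hA).lintegral_totalLoss hm hT hu

theorem ae_tsum_eq_one [IsFiniteMeasure μ] (hw : IsConditionalLaw μ T m w) (hm : m ≤ mΩ)
    (hT : Measurable T) : ∀ᵐ ω ∂μ, ∑' θ, w ω θ = 1 := by
  have hmeas : Measurable[m] fun ω => ∑' θ, w ω θ :=
    (Measurable.tsum measurable_pi_apply).comp hw.measurable
  refine ae_of_ae_trim hm (ae_eq_of_forall_setLIntegral_eq_of_sigmaFinite hmeas measurable_const
    fun A hA _ => ?_)
  rw [setLIntegral_trim hm hmeas hA, setLIntegral_trim hm measurable_const hA]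
  simpa only [totalLoss, Pi.one_apply, mul_one] using
    hw.setLIntegral_totalLoss hm hT (u := fun _ => 1) measurable_const hA

theorem condExp_ae_eq [IsFiniteMeasure μ] (hw : IsConditionalLaw μ T m w) (hm : m ≤ mΩ)
    (hT : Measurable T) (A : Set Θ) :
    μ⟦T ⁻¹' A|m⟧ =ᵐ[μ] fun ω => (totalLoss (w ω) (A.indicator 1)).toReal := by
  have hmeas : Measurable[m] fun ω => totalLoss (w ω) (A.indicator 1) :=
    (measurable_totalLoss _).comp hw.measurable
  have hAT : MeasurableSet (T ⁻¹' A) := hT A.to_countable.measurableSet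
  have hset {D : Set Ω} (hD : MeasurableSet[m] D) :
      ∫⁻ ω in D, totalLoss (w ω) (A.indicator 1) ∂μ = μ (T ⁻¹' A ∩ D) := by
    rw [hw.setLIntegral_totalLoss hm hT measurable_const hD, ← Measure.restrict_apply hAT,
      ← lintegral_indicator_one hAT]
    rfl
  have hfin : ∀ᵐ ω ∂μ, totalLoss (w ω) (A.indicator 1) < ∞ :=
    ae_lt_top (hmeas.mono hm le_rfl) (by rw [← setLIntegral_univ, hset .univ]; finiteness)
  refine (ae_eq_condExp_of_forall_setIntegral_eq hm ((integrable_const 1).indicator hAT)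
    (fun D hD _ => ?_) (fun D hD _ => ?_)
    hmeas.ennreal_toReal.stronglyMeasurable.aestronglyMeasurable).symm
  · exact integrable_toReal_of_lintegral_ne_top (hmeas.mono hm le_rfl).aemeasurable
      (by rw [hset hD]; finiteness)
  · rw [integral_toReal (hmeas.mono hm le_rfl).aemeasurable (ae_restrict_of_ae hfin), hset hD,
      setIntegral_indicator hAT, setIntegral_const, smul_eq_mul, mul_one, measureReal_def,
      Set.inter_comm]

end IsConditionalLaw

namespace BayesStopping

variable {S O : Type*} [MeasurableSpace S] {mO : MeasurableSpace O} {P : BayesStopping Θ S O}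
  {s : Ω → S} {o : Ω → O}

theorem ae_ae_tsum_reweight_ne_top [Countable Θ] [MeasurableSpace Θ] [MeasurableSingletonClass Θ]
    [IsFiniteMeasure μ] (P : BayesStopping Θ S O) (hm : m ≤ mΩ) (hT : Measurable T)
    (hw : IsConditionalLaw μ T m w) (s : Ω → S) :
    ∀ᵐ ω ∂μ, ∀ᵐ z ∂P.dominating (s ω), ∑' θ, P.reweight (s ω) z (w ω) θ ≠ ∞ := by
  filter_upwards [hw.ae_tsum_eq_one hm hT] with ω hω
  have hint : ∫⁻ z, ∑' θ, P.reweight (s ω) z (w ω) θ ∂P.dominating (s ω) ≠ ∞ := by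
    rw [P.lintegral_tsum_reweight, hω]
    exact ENNReal.one_ne_top
  exact (ae_lt_top (P.measurable_tsum_reweight _ _) hint).mono fun z => ne_of_lt

/-- In the problem `P` with parameter `T`, when the past is `m` and the state is `s`, the next
observation is `o`. -/
structure IsObservation (P : BayesStopping Θ S O) (μ : Measure Ω) (T : Ω → Θ)
    (m : MeasurableSpace Ω) (s : Ω → S) (o : Ω → O) : Prop where
  measurable_state : Measurable[m] s
  measurable_obs : Measurable[mΩ] o
  measure_inter : ∀ θ A C, MeasurableSet[m] A → MeasurableSet C →
    μ (T ⁻¹' {θ} ∩ A ∩ o ⁻¹' C) = ∫⁻ ω in T ⁻¹' {θ} ∩ A, P.obsLaw (s ω) θ C ∂μ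

namespace IsObservation

theorem restrict (ho : P.IsObservation μ T m s o) (hm : m ≤ mΩ) {A : Set Ω}
    (hA : MeasurableSet[m] A) : P.IsObservation (μ.restrict A) T m s o where
  measurable_state := ho.measurable_state
  measurable_obs := ho.measurable_obs
  measure_inter θ D C hD hC := by
    rw [Measure.restrict_restrict' (hm A hA), Measure.restrict_apply' (hm A hA),
      Set.inter_right_comm, Set.inter_assoc _ D A]
    exact ho.measure_inter θ _ C (hD.inter hA) hC

variable [Countable S] [DiscreteMeasurableSpace S]

theorem lintegral_fiber [IsFiniteMeasure μ] (ho : P.IsObservation μ T m s o) (hm : m ≤ mΩ) (θ : Θ)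
    {Φ : Ω × O → ℝ≥0∞} (hΦ : Measurable[m.prod mO] Φ) :
    ∫⁻ ω in T ⁻¹' {θ}, Φ (ω, o ω) ∂μ =
      ∫⁻ ω in T ⁻¹' {θ}, ∫⁻ z, Φ (ω, z) ∂P.obsLaw (s ω) θ ∂μ := by
  let κ : Kernel S O := Kernel.ofFunOfCountable fun s => P.obsLaw s θ
  have : IsMarkovKernel κ := ⟨fun s => P.isProbabilityMeasure_obsLaw s θ⟩
  refine @lintegral_comp_prodMk Ω Ω O mΩ m _ _ _
    (Kernel.comap (mγ := m) κ s ho.measurable_state) _ id _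
    (measurable_id'' hm) ho.measurable_obs (fun A C hA hC => ?_) Φ hΦ
  rw [Set.preimage_id, Measure.restrict_apply ((hm A hA).inter (ho.measurable_obs hC)),
    Measure.restrict_restrict (hm A hA), Set.inter_comm A (T ⁻¹' {θ}), Set.inter_comm,
    ← Set.inter_assoc]
  exact ho.measure_inter θ A C hA hC

theorem measurable_lintegral (ho : P.IsObservation μ T m s o)
    (ν : S → Measure O) [∀ s, SFinite (ν s)] {Φ : Ω × O → ℝ≥0∞}
    (hΦ : Measurable[m.prod mO] Φ) :
    Measurable[m] fun ω => ∫⁻ z, Φ (ω, z) ∂ν (s ω) :=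
  measurable_lintegral_of_countable ho.measurable_state hΦ

variable [Countable Θ]

theorem measurable_reweight (ho : P.IsObservation μ T m s o) (hw : Measurable[m] w) :
    Measurable[m.prod mO] fun x : Ω × O => P.reweight (s x.1) x.2 (w x.1) :=
  (measurable_from_prod_countable_right (f := fun y : S × ((Θ → ℝ≥0∞) × O) =>
    P.reweight y.1 y.2.2 y.2.1) P.measurable_reweight).comp
    ((ho.measurable_state.comp measurable_fst).prodMk
      ((hw.comp measurable_fst).prodMk measurable_snd))

theorem measurable_normalized_reweight (ho : P.IsObservation μ T m s o) (hw : Measurable[m] w) :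
    Measurable[m.prod mO] fun x : Ω × O =>
      normalized (P.reweight (s x.1) x.2 (w x.1)) :=
  measurable_normalized.comp (ho.measurable_reweight hw)

variable [IsFiniteMeasure μ]

theorem lintegral_fiber_eq_reweight (ho : P.IsObservation μ T m s o) (hm : m ≤ mΩ)
    (hw : IsConditionalLaw μ T m w) (θ : Θ) {Φ : Ω × O → ℝ≥0∞}
    (hΦ : Measurable[m.prod mO] Φ) :
    ∫⁻ ω in T ⁻¹' {θ}, Φ (ω, o ω) ∂μ =
      ∫⁻ ω, ∫⁻ z, P.reweight (s ω) z (w ω) θ * Φ (ω, z) ∂P.dominating (s ω) ∂μ := by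
  rw [ho.lintegral_fiber hm θ hΦ,
    hw.lintegral_fiber hm θ (ho.measurable_lintegral (P.obsLaw · θ) hΦ)]
  refine lintegral_congr fun ω => ?_
  have hΦω : Measurable fun z => Φ (ω, z) := hΦ.comp (@measurable_prodMk_left _ _ m _ ω)
  rw [← lintegral_rnDeriv_mul (P.obsLaw_absolutelyContinuous_dominating (s ω) θ) hΦω.aemeasurable]
  simp only [reweight, mul_assoc]
  exact (lintegral_const_mul _ ((P.measurable_density (s ω) θ).mul hΦω)).symm

variable [MeasurableSpace Θ] [MeasurableSingletonClass Θ]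

theorem lintegral_eq_tsum_reweight (ho : P.IsObservation μ T m s o) (hm : m ≤ mΩ)
    (hT : Measurable T) (hw : IsConditionalLaw μ T m w) {Φ : Ω × O → ℝ≥0∞}
    (hΦ : Measurable[m.prod mO] Φ) :
    ∫⁻ ω, Φ (ω, o ω) ∂μ =
      ∫⁻ ω, ∫⁻ z, (∑' θ, P.reweight (s ω) z (w ω) θ) * Φ (ω, z) ∂P.dominating (s ω) ∂μ := by
  have hmeas (θ : Θ) : Measurable[m.prod mO] fun x : Ω × O =>
      P.reweight (s x.1) x.2 (w x.1) θ * Φ x :=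
    ((measurable_pi_apply θ).comp (ho.measurable_reweight hw.measurable)).mul hΦ
  rw [IsConditionalLaw.lintegral_eq_tsum_fiber hT]
  simp only [ho.lintegral_fiber_eq_reweight hm hw _ hΦ, ← ENNReal.tsum_mul_right]
  rw [← lintegral_tsum fun θ =>
    ((ho.measurable_lintegral P.dominating (hmeas θ)).mono hm le_rfl).aemeasurable]
  refine lintegral_congr fun ω => (lintegral_tsum fun θ => ?_).symm
  exact ((hmeas θ).comp (@measurable_prodMk_left _ _ m _ ω)).aemeasurable

theorem lintegral_eq_of_mul_eq (ho : P.IsObservation μ T m s o) (hm : m ≤ mΩ)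
    (hT : Measurable T) (hw : IsConditionalLaw μ T m w) {Φ Ψ : Ω × O → ℝ≥0∞}
    (hΦ : Measurable[m.prod mO] Φ)
    (h : ∀ ω z, ∑' θ, P.reweight (s ω) z (w ω) θ ≠ ∞ →
      (∑' θ, P.reweight (s ω) z (w ω) θ) * Φ (ω, z) = Ψ (ω, z)) :
    ∫⁻ ω, Φ (ω, o ω) ∂μ = ∫⁻ ω, ∫⁻ z, Ψ (ω, z) ∂P.dominating (s ω) ∂μ := by
  rw [ho.lintegral_eq_tsum_reweight hm hT hw hΦ]
  refine lintegral_congr_ae ?_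
  filter_upwards [P.ae_ae_tsum_reweight_ne_top hm hT hw s] with ω hω
  exact lintegral_congr_ae (hω.mono fun z => h ω z)

theorem measure_fiber_inter (ho : P.IsObservation μ T m s o) (hm : m ≤ mΩ) (hT : Measurable T)
    (hw : IsConditionalLaw μ T m w) (θ : Θ) {B : Set (Ω × O)}
    (hB : MeasurableSet[m.prod mO] B) :
    μ (T ⁻¹' {θ} ∩ (fun ω => (ω, o ω)) ⁻¹' B) =
      ∫⁻ ω in (fun ω => (ω, o ω)) ⁻¹' B, normalized (P.reweight (s ω) (o ω) (w ω)) θ ∂μ := by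
  have hBo : MeasurableSet[mΩ] ((fun ω => (ω, o ω)) ⁻¹' B) :=
    ((measurable_id'' hm).prodMk ho.measurable_obs) hB
  have hind : Measurable[m.prod mO] (B.indicator (1 : Ω × O → ℝ≥0∞)) :=
    (measurable_const (a := (1 : ℝ≥0∞))).indicator hB
  calc μ (T ⁻¹' {θ} ∩ (fun ω => (ω, o ω)) ⁻¹' B)
      = ∫⁻ ω in T ⁻¹' {θ}, B.indicator 1 (ω, o ω) ∂μ := by
        rw [Set.inter_comm, ← Measure.restrict_apply hBo, ← lintegral_indicator_one hBo]
        rfl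
    _ = ∫⁻ ω, ∫⁻ z, P.reweight (s ω) z (w ω) θ * B.indicator 1 (ω, z) ∂P.dominating (s ω) ∂μ :=
        ho.lintegral_fiber_eq_reweight hm hw θ hind
    _ = ∫⁻ ω, normalized (P.reweight (s ω) (o ω) (w ω)) θ * B.indicator 1 (ω, o ω) ∂μ :=
        (ho.lintegral_eq_of_mul_eq hm hT hw
          (Φ := fun x => normalized (P.reweight (s x.1) x.2 (w x.1)) θ * B.indicator 1 x)
          (Ψ := fun x => P.reweight (s x.1) x.2 (w x.1) θ * B.indicator 1 x)
          (((measurable_pi_apply θ).comp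
            (ho.measurable_normalized_reweight hw.measurable)).mul hind)
          fun ω z hz => by simp only [← mul_assoc, tsum_mul_normalized hz]).symm
    _ = ∫⁻ ω in (fun ω => (ω, o ω)) ⁻¹' B, normalized (P.reweight (s ω) (o ω) (w ω)) θ ∂μ := by
        rw [← lintegral_indicator hBo]
        refine lintegral_congr fun ω => ?_
        by_cases h : (ω, o ω) ∈ B <;> simp [h]

theorem isConditionalLaw_sup (ho : P.IsObservation μ T m s o) (hm : m ≤ mΩ)
    (hT : Measurable T) (hw : IsConditionalLaw μ T m w) :
    IsConditionalLaw μ T (m ⊔ mO.comap o)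
      fun ω => normalized (P.reweight (s ω) (o ω) (w ω)) := by
  have hsup : m ⊔ mO.comap o =
      (m.prod mO).comap fun ω => (ω, o ω) := by
    have hcomap := MeasurableSpace.comap_prodMk (mβ := m) (mγ := mO) (id : Ω → Ω) o
    rw [MeasurableSpace.comap_id] at hcomap
    exact hcomap.symm
  have hpair : Measurable[m ⊔ mO.comap o, m.prod mO] fun ω => (ω, o ω) := by
    rw [hsup]
    exact @comap_measurable _ _ (m.prod mO) _
  have hnorm : Measurable[m ⊔ mO.comap o] fun ω => normalized (P.reweight (s ω) (o ω) (w ω)) :=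
    fun A hA => hpair (ho.measurable_normalized_reweight hw.measurable hA)
  refine ⟨hnorm, fun θ A hA => ?_⟩
  rw [hsup] at hA
  obtain ⟨B, hB, rfl⟩ := hA
  exact ho.measure_fiber_inter hm hT hw θ hB

theorem lintegral_contCost (ho : P.IsObservation μ T m s o) (hm : m ≤ mΩ) (hT : Measurable T)
    (hw : IsConditionalLaw μ T m w) (n : ℕ) :
    ∫⁻ ω, P.contCost n (s ω) (w ω) ∂μ = ∫⁻ ω, P.runLoss (s ω) (T ω) ∂μ +
      ∫⁻ ω, P.value n (P.next (s ω) (o ω)) (normalized (P.reweight (s ω) (o ω) (w ω))) ∂μ := by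
  have hrun : Measurable[m] fun ω => P.runLoss (s ω) :=
    (measurable_of_countable P.runLoss).comp ho.measurable_state
  have htotal : Measurable[m] fun ω => totalLoss (w ω) (P.runLoss (s ω)) :=
    (measurable_from_prod_countable_right (f := fun x : S × (Θ → ℝ≥0∞) =>
      totalLoss x.2 (P.runLoss x.1)) fun t => measurable_totalLoss (P.runLoss t)).comp
      (ho.measurable_state.prodMk hw.measurable)
  have hvalue : Measurable[m.prod mO] fun x : Ω × O =>
      P.value n (P.next (s x.1) x.2) (normalized (P.reweight (s x.1) x.2 (w x.1))) :=
    (measurable_from_prod_countable_right (f := fun x : S × (Θ → ℝ≥0∞) => P.value n x.1 x.2)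
      (P.measurable_value n)).comp (((measurable_from_prod_countable_right
        (f := fun y : S × O => P.next y.1 y.2) P.measurable_next).comp
        ((ho.measurable_state.comp measurable_fst).prodMk measurable_snd)).prodMk
        (ho.measurable_normalized_reweight hw.measurable))
  have hcont := ho.lintegral_eq_of_mul_eq hm hT hw hvalue
    (Ψ := fun x => P.value n (P.next (s x.1) x.2) (P.reweight (s x.1) x.2 (w x.1)))
    fun ω z hz => by
      rw [← P.value_smul]
      exact congrArg _ (funext fun θ => tsum_mul_normalized hz θ)
  rw [hcont, ← hw.lintegral_totalLoss hm hT hrun,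
    ← lintegral_add_left (htotal.mono hm le_rfl)]
  rfl

end IsObservation
end BayesStopping
end BayesFilter

section BayesRealization

open Filter Topology

variable {Ω Θ S O : Type*} {mΩ : MeasurableSpace Ω} [MeasurableSpace S] {mO : MeasurableSpace O}

namespace BayesStopping

section Density

variable [Countable Θ] (P : BayesStopping Θ S O)

theorem ae_forall_mem_density_eq (s : S) {A : Set O} (hA : MeasurableSet A) {B : Set Θ}
    (h : ∀ θ ∈ B, ∀ θ' ∈ B, (P.obsLaw s θ).restrict A = (P.obsLaw s θ').restrict A) :
    ∀ᵐ z ∂P.dominating s, z ∈ A → ∀ θ ∈ B, ∀ θ' ∈ B, P.density s θ z = P.density s θ' z := by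
  have hrestrict (θ : Θ) : ∀ᵐ z ∂P.dominating s, z ∈ A →
      ((P.obsLaw s θ).restrict A).rnDeriv (P.dominating s) z = P.density s θ z := by
    filter_upwards [Measure.rnDeriv_restrict (P.obsLaw s θ) (P.dominating s) hA] with z hz hzA
    rw [hz, Set.indicator_of_mem hzA, density]
  filter_upwards [ae_all_iff.2 hrestrict] with z hz hzA θ hθ θ' hθ'
  rw [← hz θ hzA, ← hz θ' hzA, h θ hθ θ' hθ']

end Density

/-- The law of the parameter given the observations `o 0, …, o (k - 1)`, when its prior law is
`f` and the process of states is `s`. -/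
noncomputable def posteriorLaw [Countable Θ] (P : BayesStopping Θ S O) (f : Θ → ℝ≥0∞)
    (s : ℕ → Ω → S) (o : ℕ → Ω → O) : ℕ → Ω → Θ → ℝ≥0∞
  | 0 => fun _ => f
  | k + 1 => fun ω => normalized (P.reweight (s k ω) (o k ω) (posteriorLaw P f s o k ω))

/-- The processes of states `s` and observations `o` are a realization of the problem `P` with
parameter `T`, where `o k` is observed at time `k + 1`; `ℱ k` is the information on
`o 0, …, o (k - 1)`. -/
structure IsRealization (P : BayesStopping Θ S O) (μ : Measure Ω) (T : Ω → Θ)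
    (ℱ : Filtration ℕ mΩ) (s : ℕ → Ω → S) (o : ℕ → Ω → O) : Prop where
  filtration_zero : ℱ 0 = ⊥
  filtration_succ : ∀ k, ℱ (k + 1) = ℱ k ⊔ mO.comap (o k)
  isObservation : ∀ k, P.IsObservation μ T (ℱ k) (s k) (o k)
  state_succ : ∀ k ω, s (k + 1) ω = P.next (s k ω) (o k ω)

variable [Countable Θ] {P : BayesStopping Θ S O} {μ : Measure Ω} {T : Ω → Θ}
  {ℱ : Filtration ℕ mΩ} {s : ℕ → Ω → S} {o : ℕ → Ω → O} {f : Θ → ℝ≥0∞}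

theorem exists_posteriorLaw_eq_mul {F : S → Set Θ} (hF : ∀ s z, F (P.next s z) ⊆ F s) {ω : Ω}
    (hs : ∀ k, s (k + 1) ω = P.next (s k ω) (o k ω))
    (hd : ∀ k, ∀ θ ∈ F (s (k + 1) ω), ∀ θ' ∈ F (s (k + 1) ω),
      P.density (s k ω) θ (o k ω) = P.density (s k ω) θ' (o k ω)) (k : ℕ) :
    ∃ a, ∀ θ ∈ F (s k ω), P.posteriorLaw f s o k ω θ = a * f θ := by
  induction k with
  | zero => exact ⟨1, fun θ _ => (one_mul _).symm⟩
  | succ k ih =>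
    obtain ⟨a, ha⟩ := ih
    rcases (F (s (k + 1) ω)).eq_empty_or_nonempty with h | ⟨θ₀, hθ₀⟩
    · exact ⟨0, by simp [h]⟩
    · refine ⟨(∑' θ, P.reweight (s k ω) (o k ω) (P.posteriorLaw f s o k ω) θ)⁻¹ *
        (a * P.density (s k ω) θ₀ (o k ω)), fun θ hθ => ?_⟩
      simp only [posteriorLaw, normalized, Pi.smul_apply, smul_eq_mul, reweight]
      rw [ha θ (hF _ _ (hs k ▸ hθ)), hd k θ hθ θ₀ hθ₀]
      ring

namespace IsRealization

variable [MeasurableSpace Θ] [MeasurableSingletonClass Θ] [Countable S] [DiscreteMeasurableSpace S]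

theorem ae_of_forall_ae_dominating (h : P.IsRealization μ T ℱ s o) (hT : Measurable T) (k : ℕ)
    {q : S → O → Prop} (hq : ∀ s, ∀ᵐ z ∂P.dominating s, q s z) : ∀ᵐ ω ∂μ, q (s k ω) (o k ω) := by
  have hnull (t : S) (θ : Θ) :
      μ (T ⁻¹' {θ} ∩ s k ⁻¹' {t} ∩ o k ⁻¹' toMeasurable (P.dominating t) {z | ¬q t z}) = 0 := by
    have hst := (h.isObservation k).measurable_state (measurableSet_singleton t)
    rw [(h.isObservation k).measure_inter θ _ _ hst (measurableSet_toMeasurable _ _)]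
    refine (setLIntegral_congr_fun ((hT (measurableSet_singleton θ)).inter (ℱ.le k _ hst))
      fun ω hω => ?_).trans lintegral_zero
    rw [show s k ω = t from hω.2]
    exact P.obsLaw_absolutelyContinuous_dominating t θ ((measure_toMeasurable _).trans (hq t))
  filter_upwards [ae_all_iff.2 fun t => ae_all_iff.2 fun θ =>
    measure_eq_zero_iff_ae_notMem.1 (hnull t θ)] with ω hω
  by_contra hneg
  exact hω (s k ω) (T ω) ⟨⟨rfl, rfl⟩, subset_toMeasurable _ _ hneg⟩

variable [IsProbabilityMeasure μ]

theorem isConditionalLaw_posteriorLaw (h : P.IsRealization μ T ℱ s o) (hT : Measurable T) (k : ℕ) :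
    IsConditionalLaw μ T (ℱ k) (P.posteriorLaw (fun θ => μ (T ⁻¹' {θ})) s o k) := by
  induction k with
  | zero =>
    refine ⟨measurable_const, fun θ A hA => ?_⟩
    rw [h.filtration_zero, MeasurableSpace.measurableSet_bot_iff] at hA
    rcases hA with rfl | rfl <;> simp [posteriorLaw]
  | succ k ih =>
    rw [h.filtration_succ k]
    exact (h.isObservation k).isConditionalLaw_sup (ℱ.le k) hT ih

theorem isValueIteration (h : P.IsRealization μ T ℱ s o) (hT : Measurable T) {w : ℕ → Ω → Θ → ℝ≥0∞}
    (hw : w = P.posteriorLaw (fun θ => μ (T ⁻¹' {θ})) s o) :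
    IsValueIteration ℱ μ (fun k ω => totalLoss (w k ω) (P.stopLoss (s k ω)))
      (fun k ω => P.runLoss (s k ω) (T ω)) (fun n k ω => P.value n (s k ω) (w k ω))
      (fun n k ω => P.contCost n (s k ω) (w k ω)) where
  measurable_cont n k := by
    have hwk := hw ▸ h.isConditionalLaw_posteriorLaw hT k
    exact (measurable_from_prod_countable_right (f := fun x : S × (Θ → ℝ≥0∞) =>
      P.contCost n x.1 x.2) (P.measurable_contCost n)).comp
      (((h.isObservation k).measurable_state.mono (ℱ.le k) le_rfl).prodMk
        (hwk.measurable.mono (ℱ.le k) le_rfl))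
  value_zero _ := rfl
  value_succ _ _ _ := rfl
  setLIntegral_cont n k A hA := by
    have hwk := hw ▸ h.isConditionalLaw_posteriorLaw hT k
    rw [((h.isObservation k).restrict (ℱ.le k) hA).lintegral_contCost (ℱ.le k) hT
      (hwk.restrict (ℱ.le k) hA) n]
    simp only [h.state_succ, hw, posteriorLaw]
  antitone_cont k ω := P.antitone_contCost _ _

theorem setLIntegral_totalLoss_stopLoss (h : P.IsRealization μ T ℱ s o) (hT : Measurable T) (k : ℕ)
    {A : Set Ω} (hA : MeasurableSet[ℱ k] A) :
    ∫⁻ ω in A, totalLoss (P.posteriorLaw (fun θ => μ (T ⁻¹' {θ})) s o k ω) (P.stopLoss (s k ω)) ∂μ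
      = ∫⁻ ω in A, P.stopLoss (s k ω) (T ω) ∂μ :=
  (h.isConditionalLaw_posteriorLaw hT k).setLIntegral_totalLoss (ℱ.le k) hT
    ((measurable_of_countable P.stopLoss).comp (h.isObservation k).measurable_state) hA

theorem expectedCost_le_expectedCost (h : P.IsRealization μ T ℱ s o) (hT : Measurable T)
    {a b : ℝ≥0∞} (ha : a ≠ ∞) (hb : b ≠ ∞) (h_stopping : ∀ s θ, P.stopLoss s θ ≤ a)
    (hrun : ∀ s θ, P.runLoss s θ ≤ b)
    (hlim : Tendsto (fun k => ∫⁻ ω, P.stopLoss (s k ω) (T ω) ∂μ) atTop (𝓝 0))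
    {τ τ' : Ω → ℕ∞} (hτ : IsStoppingTime ℱ τ)
    (hopt : ∀ᵐ ω ∂μ, ∀ k : ℕ, k ≤ τ ω → (τ ω = k ↔
      P.StopOptimal (s k ω) (P.posteriorLaw (fun θ => μ (T ⁻¹' {θ})) s o k ω)))
    (hτ' : IsStoppingTime ℱ τ') :
    expectedCost μ (fun k ω => P.stopLoss (s k ω) (T ω)) (fun k ω => P.runLoss (s k ω) (T ω)) τ ≤
      expectedCost μ (fun k ω => P.stopLoss (s k ω) (T ω))
        (fun k ω => P.runLoss (s k ω) (T ω)) τ' := by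
  have hcost {τ : Ω → ℕ∞} (hτ : IsStoppingTime ℱ τ) :
      expectedCost μ (fun k ω => P.stopLoss (s k ω) (T ω)) (fun k ω => P.runLoss (s k ω) (T ω)) τ =
        expectedCost μ (fun k ω => totalLoss (P.posteriorLaw (fun θ => μ (T ⁻¹' {θ})) s o k ω)
          (P.stopLoss (s k ω))) (fun k ω => P.runLoss (s k ω) (T ω)) τ :=
    tsum_congr fun k => by
      rw [stageCost, stageCost,
        h.setLIntegral_totalLoss_stopLoss hT k (measurableSet_eq_natCast hτ k)]
  have hint (k : ℕ) : ∫⁻ ω, totalLoss (P.posteriorLaw (fun θ => μ (T ⁻¹' {θ})) s o k ω)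
      (P.stopLoss (s k ω)) ∂μ = ∫⁻ ω, P.stopLoss (s k ω) (T ω) ∂μ := by
    simpa only [setLIntegral_univ] using h.setLIntegral_totalLoss_stopLoss hT k .univ
  have hbound {a : ℝ≥0∞} (ha : a ≠ ∞) {u : Ω → ℝ≥0∞} (hu : ∀ ω, u ω ≤ a) : ∫⁻ ω, u ω ∂μ ≠ ∞ :=
    ne_top_of_le_ne_top ha ((lintegral_mono hu).trans_eq (by simp))
  rw [hcost hτ, hcost hτ']
  refine (h.isValueIteration hT rfl).expectedCost_le_expectedCost
    (fun k => hint k ▸ hbound ha fun ω => h_stopping _ _) (fun k => hbound hb fun ω => hrun _ _)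
    ?_ hτ hopt hτ'
  simpa only [hint] using hlim

end IsRealization
end BayesStopping
end BayesRealization

section Network

variable {N m k k' b : ℕ} {s s' : NetState N} {o o' : Fin (N + 1)} {i j : Fin N}

theorem slotsToGo_eq_iff_dvd (hm : 1 ≤ m) : slotsToGo m k = m ↔ m ∣ k := by
  rw [slotsToGo, Nat.dvd_iff_mod_eq_zero]
  have := Nat.mod_lt k hm
  omega

theorem IsLast.unique (hi : IsLast s i) (hj : IsLast s j) : i = j := by
  by_contra h
  exact Bool.false_ne_true (hi.1.symm.trans (hj.2 i h))

theorem netStep_of_isLast (hj : IsLast s j) : netStep m k s j.succ =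
    { B := s.B + 1
      L := fun i => s.L i - (if j = i then 1 else 0) + (if slotsToGo m (k + 1) = m then 1 else 0)
      W := fun i => s.W i - 1
      R := fun i => decide (0 < s.W i) } := by
  have hex : ∃ j' : Fin N, j.succ = j'.succ ∧ IsLast s j' := ⟨j, rfl, hj⟩
  simp only [netStep, if_pos hex, Fin.succ_inj]

theorem netStep_of_not_isLast (ho : ∀ j : Fin N, o = j.succ → ¬IsLast s j) : netStep m k s o =
    { B := s.B
      L := fun i => s.L i - (if o = i.succ then 1 else 0) +
        (if slotsToGo m (k + 1) = m then 1 else 0)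
      W := fun i => if o = i.succ ∧ s.R i = true then s.W i + 1 else s.W i
      R := fun i => if o = i.succ then true else s.R i } := by
  have hex : ¬∃ j : Fin N, o = j.succ ∧ IsLast s j := fun ⟨j, hj⟩ => ho j hj.1 hj.2
  simp only [netStep, if_neg hex]

theorem isLast_or_not_isLast (s : NetState N) (o : Fin (N + 1)) :
    (∃ j : Fin N, o = j.succ ∧ IsLast s j) ∨ ∀ j : Fin N, o = j.succ → ¬IsLast s j := by
  simpa only [not_exists, not_and] using em (∃ j : Fin N, o = j.succ ∧ IsLast s j)

theorem B_le_netStep (m k : ℕ) (s : NetState N) (o : Fin (N + 1)) : s.B ≤ (netStep m k s o).B := by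
  rcases isLast_or_not_isLast s o with ⟨j, rfl, hj⟩ | ho
  · simp only [netStep_of_isLast hj, Nat.le_succ]
  · simp only [netStep_of_not_isLast ho, le_refl]

theorem netState_congr {o o' : ℕ → Fin (N + 1)} (h : ∀ l < k, o l = o' l) :
    netState m o k = netState m o' k := by
  induction k with
  | zero => rfl
  | succ k ih => rw [netState, netState, ih fun l hl => h l (hl.trans k.lt_succ_self),
      h k k.lt_succ_self]

theorem one_le_netState_B (m : ℕ) (o : ℕ → Fin (N + 1)) (k : ℕ) : 1 ≤ (netState m o k).B := by
  induction k with
  | zero => exact le_rfl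
  | succ k ih => exact ih.trans (B_le_netStep m k _ _)

theorem eq_of_netStep_eq_of_not_isLast (ho : ∀ j : Fin N, o = j.succ → ¬IsLast s j)
    (ho' : ∀ j : Fin N, o' = j.succ → ¬IsLast s j)
    (hW : (netStep m k s o).W = (netStep m k s o').W)
    (hR : (netStep m k s o).R = (netStep m k s o').R) : o = o' := by
  rw [netStep_of_not_isLast ho, netStep_of_not_isLast ho'] at hW hR
  have hiff (j : Fin N) : o = j.succ ↔ o' = j.succ := by
    have hWj := congrFun hW j
    have hRj := congrFun hR j
    simp only at hWj hRj
    by_cases h : o = j.succ <;> by_cases h' : o' = j.succ <;> cases hj : s.R j <;> simp_all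
  cases o using Fin.cases with
  | succ j => exact ((hiff j).1 rfl).symm
  | zero =>
    cases o' using Fin.cases with
    | zero => rfl
    | succ j => exact (hiff j).2 rfl

theorem eq_of_netStep_eq (hB : (netStep m k s o).B = (netStep m k s o').B)
    (hW : (netStep m k s o).W = (netStep m k s o').W)
    (hR : (netStep m k s o).R = (netStep m k s o').R) : o = o' := by
  rcases isLast_or_not_isLast s o with ⟨j, rfl, hj⟩ | ho <;>
    rcases isLast_or_not_isLast s o' with ⟨j', rfl, hj'⟩ | ho'
  · rw [hj.unique hj']
  · simp [netStep_of_isLast hj, netStep_of_not_isLast ho'] at hB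
  · simp [netStep_of_isLast hj', netStep_of_not_isLast ho] at hB
  · exact eq_of_netStep_eq_of_not_isLast ho ho' hW hR

/-- Only a node with a nonempty queue transmits. -/
def Possible (s : NetState N) (o : Fin (N + 1)) : Prop := ∀ i : Fin N, o = i.succ → 0 < s.L i

/-- The configurations satisfying the invariants of slot `k`, the main one being that each sensor
has taken `k / m` samples, which are received, sequenced or queued. -/
structure Reachable (m k : ℕ) (s : NetState N) : Prop where
  B_pos : 1 ≤ s.B
  count : ∀ i, s.B + (if s.R i = true then 1 else 0) + s.W i + s.L i = k / m + 1
  W_eq_zero : ∀ i, s.R i = false → s.W i = 0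
  L_pos : ∀ i, m ∣ k → 1 ≤ k → 1 ≤ s.L i

namespace Reachable

theorem netState_zero (m : ℕ) (o : ℕ → Fin (N + 1)) : Reachable m 0 (netState m o 0) where
  B_pos := le_rfl
  count i := by simp [netState]
  W_eq_zero i _ := rfl
  L_pos i _ h := absurd h (by decide)

theorem count_netStep (hm : 1 ≤ m) (hs : Reachable m k s) (ho : Possible s o) (i : Fin N) :
    (netStep m k s o).B + (if (netStep m k s o).R i = true then 1 else 0) +
      (netStep m k s o).W i + (netStep m k s o).L i = (k + 1) / m + 1 := by
  have hcount := hs.count i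
  have hW := hs.W_eq_zero i
  have hL := ho i
  simp only [Nat.succ_div, ← slotsToGo_eq_iff_dvd hm]
  rcases isLast_or_not_isLast s o with ⟨j, rfl, hj⟩ | ho
  · simp only [netStep_of_isLast hj, decide_eq_true_eq]
    by_cases hij : j = i
    · subst hij
      have := hL rfl
      simp only [hW hj.1, hj.1, Bool.false_eq_true, if_true, if_false, lt_irrefl] at hcount ⊢
      omega
    · simp only [hj.2 i (Ne.symm hij), if_neg hij, if_true] at hcount ⊢
      split_ifs <;> omega
  · simp only [netStep_of_not_isLast ho]
    by_cases hi : o = i.succ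
    · have := hL hi
      cases hR : s.R i <;>
        simp only [hR, hi, true_and, if_true, if_false, Bool.false_eq_true] at hcount ⊢ <;> omega
    · simp only [hi, false_and, if_false]
      omega

theorem netStep (hm : 1 ≤ m) (hs : Reachable m k s) (ho : Possible s o) :
    Reachable m (k + 1) (netStep m k s o) where
  B_pos := hs.B_pos.trans (B_le_netStep m k s o)
  count := hs.count_netStep hm ho
  W_eq_zero i := by
    have hW := hs.W_eq_zero i
    rcases isLast_or_not_isLast s o with ⟨j, rfl, hj⟩ | ho
    · simp only [netStep_of_isLast hj, decide_eq_false_iff_not]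
      omega
    · rw [netStep_of_not_isLast ho]
      by_cases hi : o = i.succ
      · simp [hi]
      · simpa [hi] using hW
  L_pos i hdvd _ := by
    simp only [NADM.netStep, if_pos ((slotsToGo_eq_iff_dvd hm).2 hdvd)]
    omega

theorem netState (hm : 1 ≤ m) {o : ℕ → Fin (N + 1)} (k : ℕ)
    (ho : ∀ l < k, Possible (netState m o l) (o l)) : Reachable m k (netState m o k) := by
  induction k with
  | zero => exact netState_zero m o
  | succ k ih =>
    exact netStep hm (ih fun l hl => ho l (hl.trans k.lt_succ_self)) (ho k k.lt_succ_self)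

theorem mul_le_of_queued (hs : Reachable m k s) (h : 0 < s.L i) : s.B * m ≤ k := by
  have := hs.count i
  exact (Nat.mul_le_mul_right m (by omega : s.B ≤ k / m)).trans (Nat.div_mul_le_self k m)

theorem mul_le_of_sequenced (hs : Reachable m k s) (h : 0 < s.W i) : (s.B + 1) * m ≤ k := by
  have hcount := hs.count i
  rw [if_pos (Bool.of_not_eq_false (mt (hs.W_eq_zero i) h.ne'))] at hcount
  exact (Nat.mul_le_mul_right m (by omega : s.B + 1 ≤ k / m)).trans (Nat.div_mul_le_self k m)

end Reachable

/-- The queueing state displayed by the configuration `s` in slot `k`. -/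
def observedState (m k : ℕ) (s : NetState N) : QueueState N :=
  ⟨slotsToGo m k, s.B, k - s.B * m, s.W, s.R⟩

theorem observedState_eq_iff {q : QueueState N} : observedState m k s = q ↔
    slotsToGo m k = q.lam ∧ s.B = q.B ∧ k - s.B * m = q.Δ ∧ s.W = q.W ∧ s.R = q.R := by
  rw [QueueState.ext_iff]
  rfl

theorem mod_eq_of_slotsToGo_eq (hm : 1 ≤ m) (h : slotsToGo m k = slotsToGo m k') :
    k % m = k' % m := by
  have := Nat.mod_lt k hm
  have := Nat.mod_lt k' hm
  unfold slotsToGo at h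
  omega

theorem eq_zero_or_eq_of_observedState_eq_initial (hm : 1 ≤ m)
    (h : observedState m k s = initialQueueState N m) : k = 0 ∨ k = m := by
  simp only [observedState_eq_iff, initialQueueState] at h
  obtain ⟨hlam, hB, hΔ, -, -⟩ := h
  rw [hB, one_mul] at hΔ
  rcases k.eq_zero_or_pos with hk | hk
  · exact .inl hk
  · have := Nat.le_of_dvd hk ((slotsToGo_eq_iff_dvd hm).1 hlam)
    exact .inr (by omega)

namespace Reachable

theorem B_eq_and_dvd_of_observedState_eq (hN : 1 ≤ N) (hm : 1 ≤ m) (hs : Reachable m k s)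
    (hlt : k < k') (h : observedState m k s = observedState m k' s') : s.B = k / m + 1 ∧ m ∣ k := by
  obtain ⟨hlam, hB, hΔ, -, -⟩ := observedState_eq_iff.1 h
  change slotsToGo m k = slotsToGo m k' at hlam
  change s.B = s'.B at hB
  change k - s.B * m = k' - s'.B * m at hΔ
  have hmod := mod_eq_of_slotsToGo_eq hm hlam
  rw [← hB] at hΔ
  have hk' : k' ≤ m * s.B := by
    rw [mul_comm]
    omega
  have hdiv : k / m < k' / m := by
    have := Nat.div_add_mod k m
    have := Nat.div_add_mod k' m
    exact lt_of_mul_lt_mul_left (by omega : m * (k / m) < m * (k' / m)) m.zero_le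
  have hdiv' : k' / m ≤ s.B := Nat.div_le_of_le_mul hk'
  have hcount := hs.count ⟨0, hN⟩
  have hB' : k' / m = s.B := by omega
  refine ⟨by omega, Nat.dvd_of_mod_eq_zero ?_⟩
  have := Nat.div_add_mod k' m
  rw [hB'] at this
  omega

theorem observedState_eq_initial (hN : 1 ≤ N) (hm : 1 ≤ m) (hs : Reachable m k s)
    (hlt : k < k') (h : observedState m k s = observedState m k' s') :
    observedState m k s = initialQueueState N m := by
  obtain ⟨hB, hdvd⟩ := hs.B_eq_and_dvd_of_observedState_eq hN hm hlt h
  have hempty (i : Fin N) : s.W i = 0 ∧ s.R i = false ∧ s.L i = 0 := by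
    have := hs.count i
    cases hR : s.R i <;> simp only [hR, if_true, if_false, Bool.false_eq_true] at this
    · exact ⟨by omega, rfl, by omega⟩
    · omega
  have hk : k = 0 := by
    by_contra hk
    have := hs.L_pos ⟨0, hN⟩ hdvd (Nat.one_le_iff_ne_zero.2 hk)
    have := (hempty ⟨0, hN⟩).2.2
    omega
  subst hk
  exact observedState_eq_iff.2 ⟨(slotsToGo_eq_iff_dvd hm).2 hdvd,
    hB.trans (by simp [initialQueueState]), Nat.zero_sub _, funext fun i => (hempty i).1,
    funext fun i => (hempty i).2.1⟩

theorem eq_of_observedState_eq_same (hs : Reachable m k s) (hs' : Reachable m k s')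
    (h : observedState m k s = observedState m k s') : s = s' := by
  obtain ⟨-, hB, -, hW, hR⟩ := observedState_eq_iff.1 h
  refine NetState.ext hB (funext fun i => ?_) hW hR
  have hcount := hs.count i
  have hcount' := hs'.count i
  change s.B = s'.B at hB
  change s.W = s'.W at hW
  change s.R = s'.R at hR
  rw [← hB, ← hW, ← hR] at hcount'
  omega

theorem eq_of_observedState_eq (hN : 1 ≤ N) (hm : 1 ≤ m) (hs : Reachable m k s)
    (hs' : Reachable m k' s') (h : observedState m k s = observedState m k' s')
    (hini : observedState m k s ≠ initialQueueState N m) : k = k' ∧ s = s' := by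
  obtain rfl : k = k' := by
    rcases lt_trichotomy k k' with hlt | heq | hlt
    · exact absurd (hs.observedState_eq_initial hN hm hlt h) hini
    · exact heq
    · exact absurd (h.trans (hs'.observedState_eq_initial hN hm hlt h.symm)) hini
  exact ⟨rfl, hs.eq_of_observedState_eq_same hs' h⟩

end Reachable

/-- The configuration at the first sampling instant. -/
def firstSamplingState (N : ℕ) : NetState N := ⟨1, fun _ => 1, fun _ => 0, fun _ => false⟩

theorem Reachable.eq_firstSamplingState (hN : 1 ≤ N) (hm : 1 ≤ m) (hs : Reachable m m s) :
    s = firstSamplingState N := by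
  have hentries (i : Fin N) : s.B = 1 ∧ s.L i = 1 ∧ s.W i = 0 ∧ s.R i = false := by
    have hB := hs.B_pos
    have hL := hs.L_pos i dvd_rfl hm
    have hcount := hs.count i
    rw [Nat.div_self hm] at hcount
    cases hR : s.R i <;> simp only [hR, if_true, if_false, Bool.false_eq_true] at hcount
    · exact ⟨by omega, by omega, by omega, rfl⟩
    · omega
  exact NetState.ext (hentries ⟨0, hN⟩).1 (funext fun i => (hentries i).2.1)
    (funext fun i => (hentries i).2.2.1) (funext fun i => (hentries i).2.2.2)

theorem delivered_eq_some_iff : delivered s o i = some b ↔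
    (o = i.succ ∧ s.R i = false ∧ b = s.B) ∨ (¬(o = i.succ ∧ s.R i = false) ∧
      (∃ j : Fin N, o = j.succ ∧ IsLast s j) ∧ 0 < s.W i ∧ b = s.B + 1) := by
  unfold delivered
  split_ifs <;> grind

theorem B_le_of_delivered (h : delivered s o i = some b) : s.B ≤ b := by
  rcases delivered_eq_some_iff.1 h with ⟨-, -, rfl⟩ | ⟨-, -, -, rfl⟩ <;> omega

theorem le_netStep_B_of_delivered (h : delivered s o i = some b) : b ≤ (netStep m k s o).B := by
  rcases delivered_eq_some_iff.1 h with ⟨-, -, rfl⟩ | ⟨-, ⟨j, rfl, hj⟩, -, rfl⟩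
  · exact B_le_netStep m k s o
  · rw [netStep_of_isLast hj]

theorem Reachable.mul_le_of_delivered (hs : Reachable m k s) (ho : Possible s o)
    (h : delivered s o i = some b) : b * m ≤ k := by
  rcases delivered_eq_some_iff.1 h with ⟨hi, -, rfl⟩ | ⟨-, -, hW, rfl⟩
  · exact hs.mul_le_of_queued (ho i hi)
  · exact hs.mul_le_of_sequenced hW

theorem Reachable.delivered_eq_none (hs : Reachable m k s) (ho : Possible s o) (hk : k < m)
    (i : Fin N) : delivered s o i = none := by
  refine Option.eq_none_iff_forall_ne_some.2 fun b hb => ?_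
  have hle := hs.mul_le_of_delivered ho hb
  have := Nat.le_mul_of_pos_left m (hs.B_pos.trans (B_le_of_delivered hb))
  omega

/-- The component `i` of batch `b` has been received by the decision maker. -/
def Received (s : NetState N) (b : ℕ) (i : Fin N) : Prop := b < s.B ∨ (b = s.B ∧ s.R i = true)

theorem Received.netStep (h : Received s b i) (m k : ℕ) (o : Fin (N + 1)) :
    Received (netStep m k s o) b i := by
  rcases isLast_or_not_isLast s o with ⟨j, rfl, hj⟩ | ho
  · rw [netStep_of_isLast hj]
    exact .inl (Nat.lt_succ_of_le (h.elim le_of_lt fun h => h.1.le))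
  · rw [netStep_of_not_isLast ho]
    exact h.imp_right fun h => ⟨h.1, by simp only [h.2, ite_self]⟩

theorem not_received_of_delivered (h : delivered s o i = some b) : ¬Received s b i := by
  intro hr
  rcases delivered_eq_some_iff.1 h with ⟨-, hR, rfl⟩ | ⟨-, -, -, rfl⟩
  · simp [Received, hR] at hr
  · simp [Received] at hr

theorem received_of_delivered (h : delivered s o i = some b) (m k : ℕ) :
    Received (netStep m k s o) b i := by
  rcases delivered_eq_some_iff.1 h with ⟨hi, -, rfl⟩ | ⟨-, ⟨j, rfl, hj⟩, hW, rfl⟩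
  · rcases isLast_or_not_isLast s o with ⟨j, rfl, hj⟩ | ho
    · rw [netStep_of_isLast hj]
      exact .inl (Nat.lt_succ_self _)
    · rw [netStep_of_not_isLast ho]
      exact .inr ⟨rfl, if_pos hi⟩
  · rw [netStep_of_isLast hj]
    exact .inr ⟨rfl, decide_eq_true hW⟩

theorem outcomeProb_nonneg {σ : ℝ} (hσ : σ ∈ Set.Icc 0 1) (s : NetState N) (o : Fin (N + 1)) :
    0 ≤ outcomeProb σ s o := by
  have h0 := hσ.1
  have h1 := sub_nonneg.2 hσ.2
  cases o using Fin.cases with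
  | zero => exact ite_nonneg zero_le_one h1
  | succ j => exact ite_nonneg (by positivity) le_rfl

theorem sum_outcomeProb (σ : ℝ) (s : NetState N) : ∑ o, outcomeProb σ s o = 1 := by
  simp only [Fin.sum_univ_succ, outcomeProb, Fin.cases_zero, Fin.cases_succ]
  rw [← Finset.sum_filter, Finset.sum_const, ← contenders, nsmul_eq_mul]
  split_ifs with h
  · simp [h]
  · rw [mul_div_cancel₀ _ (Nat.cast_ne_zero.2 h), sub_add_cancel]

theorem possible_of_outcomeProb_ne_zero {σ : ℝ} (h : outcomeProb σ s o ≠ 0) : Possible s o := by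
  rintro i rfl
  by_contra hL
  exact h (if_neg hL)

end Network

/-- The parameters of the network and of the change detection problem. -/
structure Params (N : ℕ) (𝒳 : Type*) [MeasurableSpace 𝒳] where
  m : ℕ
  σ : ℝ
  p : ℝ
  c : ℝ
  F₀ : Measure 𝒳
  F₁ : Measure 𝒳
  one_le_N : 1 ≤ N
  one_le_m : 1 ≤ m
  σ_mem : σ ∈ Set.Icc 0 1
  p_pos : 0 < p
  p_lt_one : p < 1
  isProbabilityMeasure_F₀ : IsProbabilityMeasure F₀
  isProbabilityMeasure_F₁ : IsProbabilityMeasure F₁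

attribute [instance] Params.isProbabilityMeasure_F₀ Params.isProbabilityMeasure_F₁

/-- What the decision maker learns from a slot: its outcome and the samples handed over. -/
abbrev SlotObs (N : ℕ) (𝒳 : Type*) := Fin (N + 1) × (Fin N → 𝒳 ⊕ Unit)

namespace Params

section DecisionProblem

variable {N : ℕ} {𝒳 : Type*} [MeasurableSpace 𝒳] (D : Params N 𝒳)

/-- The law of the samples of batch `b` when the change time is `t`. -/
noncomputable def sampleLaw (t b : ℕ) : Measure 𝒳 := if t ≤ b * D.m then D.F₁ else D.F₀

instance (t b : ℕ) : IsProbabilityMeasure (D.sampleLaw t b) := by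
  unfold sampleLaw
  split_ifs <;> infer_instance

/-- The law of an entry of the vector of samples handed over, when the change time is `t` and the
entry holds a sample of the given batch, if any. -/
noncomputable def entryLaw (t : ℕ) : Option ℕ → Measure (𝒳 ⊕ Unit)
  | none => Measure.dirac (Sum.inr ())
  | some b => (D.sampleLaw t b).map Sum.inl

instance (t : ℕ) (d : Option ℕ) : IsProbabilityMeasure (D.entryLaw t d) := by
  cases d with
  | none => exact Measure.dirac.isProbabilityMeasure
  | some b => exact Measure.isProbabilityMeasure_map measurable_inl.aemeasurable

/-- The law of the vector of samples handed over as a result of the outcome `o` in the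
configuration `s`, when the change time is `t`. -/
noncomputable def handedOverLaw (t : ℕ) (s : NetState N) (o : Fin (N + 1)) :
    Measure (Fin N → 𝒳 ⊕ Unit) :=
  Measure.pi fun i => D.entryLaw t (delivered s o i)

instance (t : ℕ) (s : NetState N) (o : Fin (N + 1)) :
    IsProbabilityMeasure (D.handedOverLaw t s o) := by
  unfold handedOverLaw
  infer_instance

/-- The law of the observation in a slot, given the configuration and the change time. -/
noncomputable def slotLaw (s : NetState N) (t : ℕ) : Measure (SlotObs N 𝒳) :=
  ∑ o, ENNReal.ofReal (outcomeProb D.σ s o) • (Measure.dirac o).prod (D.handedOverLaw t s o)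

theorem slotLaw_apply (s : NetState N) (t : ℕ) {C : Set (SlotObs N 𝒳)} (hC : MeasurableSet C) :
    D.slotLaw s t C =
      ∑ o, ENNReal.ofReal (outcomeProb D.σ s o) * D.handedOverLaw t s o (Prod.mk o ⁻¹' C) := by
  simp only [slotLaw, Measure.finsetSum_apply, Measure.smul_apply, smul_eq_mul, Measure.dirac_prod,
    Measure.map_apply measurable_prodMk_left hC]

instance (s : NetState N) (t : ℕ) : IsProbabilityMeasure (D.slotLaw s t) := ⟨by
  simp only [D.slotLaw_apply s t .univ, Set.preimage_univ, measure_univ, mul_one]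
  rw [← ENNReal.ofReal_sum_of_nonneg fun o _ => outcomeProb_nonneg D.σ_mem s o, sum_outcomeProb,
    ENNReal.ofReal_one]⟩

/-- Change detection as a stopping problem whose parameter is the change time and whose states are
the pairs of a slot and a configuration. Stopping before the change costs `1`, and every slot of
delay costs `c`. -/
noncomputable def decisionProblem : BayesStopping ℕ (ℕ × NetState N) (SlotObs N 𝒳) where
  obsLaw x t := D.slotLaw x.2 t
  isProbabilityMeasure_obsLaw _ _ := inferInstance
  next x z := (x.1 + 1, netStep D.m x.1 x.2 z.1)
  measurable_next x := (measurable_of_countable fun o : Fin (N + 1) =>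
    (x.1 + 1, netStep D.m x.1 x.2 o)).comp measurable_fst
  stopLoss x := (Set.Ioi x.1).indicator 1
  runLoss x := (Set.Iic x.1).indicator fun _ => ENNReal.ofReal D.c

theorem stopLoss_le (x : ℕ × NetState N) (t : ℕ) : D.decisionProblem.stopLoss x t ≤ 1 :=
  Set.indicator_le_self' (fun _ _ => zero_le) t

theorem runLoss_le (x : ℕ × NetState N) (t : ℕ) :
    D.decisionProblem.runLoss x t ≤ ENNReal.ofReal D.c :=
  Set.indicator_le_self' (f := fun _ => ENNReal.ofReal D.c) (fun _ _ => zero_le) t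

/-- The time dividing the samples handed over: those handed over in slot `x.1` or later are taken
at this time or later, the others at this time or earlier. -/
def refTime (x : ℕ × NetState N) : ℕ := min x.1 (x.2.B * D.m)

theorem refTime_le_next (x : ℕ × NetState N) (z : SlotObs N 𝒳) :
    D.refTime x ≤ D.refTime (D.decisionProblem.next x z) :=
  min_le_min x.1.le_succ (Nat.mul_le_mul_right D.m (B_le_netStep D.m x.1 x.2 z.1))

theorem handedOverLaw_congr {s : NetState N} {o : Fin (N + 1)} {t t' : ℕ}
    (h : ∀ i b, delivered s o i = some b → D.sampleLaw t b = D.sampleLaw t' b) :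
    D.handedOverLaw t s o = D.handedOverLaw t' s o := by
  unfold handedOverLaw
  congr 1
  ext1 i
  cases hd : delivered s o i with
  | none => rfl
  | some b => rw [entryLaw, entryLaw, h i b hd]

theorem isIndistinguishable_Iic_refTime :
    D.decisionProblem.IsIndistinguishable fun x => Set.Iic (D.refTime x) where
  subset_next x z := Set.Iic_subset_Iic.2 (D.refTime_le_next x z)
  obsLaw_eq x t ht t' ht' := by
    have hlaw {b t : ℕ} (hb : x.2.B ≤ b) (ht : t ≤ D.refTime x) : D.sampleLaw t b = D.F₁ :=
      if_pos ((ht.trans (min_le_right _ _)).trans (Nat.mul_le_mul_right D.m hb))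
    change D.slotLaw x.2 t = D.slotLaw x.2 t'
    refine Finset.sum_congr rfl fun o _ => ?_
    rw [D.handedOverLaw_congr fun i b hb =>
      (hlaw (B_le_of_delivered hb) ht).trans (hlaw (B_le_of_delivered hb) ht').symm]
  stopLoss_eq x t ht t' ht' := by
    have hle {t : ℕ} (ht : t ≤ D.refTime x) : t ∉ Set.Ioi x.1 :=
      not_lt.2 (ht.trans (min_le_left _ _))
    exact (Set.indicator_of_notMem (hle ht) _).trans (Set.indicator_of_notMem (hle ht') _).symm
  runLoss_eq x t ht t' ht' := by
    have heq {t : ℕ} (ht : t ≤ D.refTime x) : D.decisionProblem.runLoss x t = ENNReal.ofReal D.c :=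
      Set.indicator_of_mem (f := fun _ => ENNReal.ofReal D.c)
        (show t ∈ Set.Iic x.1 from ht.trans (min_le_left _ _))
    rw [heq ht, heq ht']

/-- The change times compatible with every sample handed over before slot `x.1` having law `F₀`.
There are no such samples up to slot `m`. -/
def unaffected (x : ℕ × NetState N) : Set ℕ := {t | D.refTime x < t ∨ x.1 ≤ D.m}

theorem unaffected_next_subset (x : ℕ × NetState N) (z : SlotObs N 𝒳) :
    D.unaffected (D.decisionProblem.next x z) ⊆ D.unaffected x := fun _ ht =>
  ht.imp (D.refTime_le_next x z).trans_lt x.1.le_succ.trans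

theorem handedOverLaw_eq_of_mem_unaffected {k : ℕ} {s : NetState N} {o : Fin (N + 1)}
    (hs : Reachable D.m k s) (ho : Possible s o) {t t' : ℕ}
    (ht : t ∈ D.unaffected (k + 1, netStep D.m k s o))
    (ht' : t' ∈ D.unaffected (k + 1, netStep D.m k s o)) :
    D.handedOverLaw t s o = D.handedOverLaw t' s o := by
  refine D.handedOverLaw_congr fun i b hb => ?_
  have hlaw {t : ℕ} (ht : t ∈ D.unaffected (k + 1, netStep D.m k s o)) :
      D.sampleLaw t b = D.F₀ := by
    have href : b * D.m ≤ D.refTime (k + 1, netStep D.m k s o) :=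
      le_min ((hs.mul_le_of_delivered ho hb).trans k.le_succ)
        (Nat.mul_le_mul_right D.m (le_netStep_B_of_delivered hb))
    rcases ht with ht | hk
    · exact if_neg (href.trans_lt ht).not_ge
    · rw [hs.delivered_eq_none ho hk i] at hb
      cases hb
  rw [hlaw ht, hlaw ht']

theorem slotLaw_restrict_eq {s : NetState N} {o : Fin (N + 1)} {t t' : ℕ}
    (h : D.handedOverLaw t s o = D.handedOverLaw t' s o) :
    (D.slotLaw s t).restrict {z | z.1 = o} = (D.slotLaw s t').restrict {z | z.1 = o} := by
  have ho : MeasurableSet {z : SlotObs N 𝒳 | z.1 = o} := measurable_fst (measurableSet_singleton o)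
  ext C hC
  rw [Measure.restrict_apply hC, Measure.restrict_apply hC, D.slotLaw_apply s t (hC.inter ho),
    D.slotLaw_apply s t' (hC.inter ho)]
  refine Finset.sum_congr rfl fun o' _ => ?_
  by_cases ho' : o' = o
  · rw [ho', h]
  · have hempty : Prod.mk o' ⁻¹' (C ∩ {z : SlotObs N 𝒳 | z.1 = o}) = ∅ :=
      Set.eq_empty_of_forall_notMem fun _ hy => ho' hy.2
    rw [hempty, measure_empty, measure_empty]

theorem ae_density_eq_of_mem_unaffected (x : ℕ × NetState N) :
    ∀ᵐ z ∂D.decisionProblem.dominating x, Reachable D.m x.1 x.2 → Possible x.2 z.1 →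
      ∀ t ∈ D.unaffected (D.decisionProblem.next x z),
        ∀ t' ∈ D.unaffected (D.decisionProblem.next x z),
          D.decisionProblem.density x t z = D.decisionProblem.density x t' z := by
  by_cases hx : Reachable D.m x.1 x.2
  swap
  · exact .of_forall fun _ h => absurd h hx
  have hout (o : Fin (N + 1)) (ho : Possible x.2 o) : ∀ᵐ z ∂D.decisionProblem.dominating x,
      z ∈ {z : SlotObs N 𝒳 | z.1 = o} → ∀ t ∈ D.unaffected (x.1 + 1, netStep D.m x.1 x.2 o),
        ∀ t' ∈ D.unaffected (x.1 + 1, netStep D.m x.1 x.2 o),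
          D.decisionProblem.density x t z = D.decisionProblem.density x t' z :=
    D.decisionProblem.ae_forall_mem_density_eq x (measurable_fst (measurableSet_singleton o))
      fun t ht t' ht' =>
        D.slotLaw_restrict_eq (D.handedOverLaw_eq_of_mem_unaffected hx ho ht ht')
  filter_upwards [ae_all_iff.2 fun o => ae_all_iff.2 (hout o)] with z hz _ ho
  exact hz z.1 ho rfl

end DecisionProblem
end Params

namespace Params

section Thresholds

open Filter Topology

variable {N : ℕ} {𝒳 : Type*} [MeasurableSpace 𝒳] (D : Params N 𝒳)

/-- The geometric law on the positive integers. -/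
noncomputable def geomWeight (t : ℕ) : ℝ≥0∞ := ENNReal.ofReal (D.p * (1 - D.p) ^ (t - 1))

/-- The tail of the geometric law. -/
noncomputable def geomTail (k : ℕ) : ℝ≥0∞ := ENNReal.ofReal ((1 - D.p) ^ k)

theorem geomTail_ne_zero (k : ℕ) : D.geomTail k ≠ 0 :=
  (ENNReal.ofReal_pos.2 (pow_pos (sub_pos.2 D.p_lt_one) k)).ne'

theorem geomTail_ne_top (k : ℕ) : D.geomTail k ≠ ∞ := ENNReal.ofReal_ne_top

theorem tsum_geomWeight_Ioi (k : ℕ) : ∑' t : Set.Ioi k, D.geomWeight t = D.geomTail k := by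
  have hp : 0 ≤ 1 - D.p := sub_nonneg.2 D.p_lt_one.le
  have hzero : ∑ t ∈ Finset.range (k + 1), (Set.Ioi k).indicator D.geomWeight t = 0 :=
    Finset.sum_eq_zero fun t ht =>
      Set.indicator_of_notMem (Set.notMem_Ioi.2 (Nat.lt_succ_iff.1 (Finset.mem_range.1 ht))) _
  have hshift (i : ℕ) : (Set.Ioi k).indicator D.geomWeight (i + (k + 1)) =
      ENNReal.ofReal ((1 - D.p) ^ k * D.p * (1 - D.p) ^ i) := by
    rw [Set.indicator_of_mem (Set.mem_Ioi.2 (by omega)), geomWeight,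
      show i + (k + 1) - 1 = k + i by omega]
    ring_nf
  have hsum : HasSum (fun i : ℕ => (1 - D.p) ^ k * D.p * (1 - D.p) ^ i) ((1 - D.p) ^ k) := by
    have h := (hasSum_geometric_of_lt_one hp (by linarith [D.p_pos])).mul_left ((1 - D.p) ^ k * D.p)
    rwa [sub_sub_cancel, mul_assoc, mul_inv_cancel₀ D.p_pos.ne', mul_one] at h
  have hnonneg (i : ℕ) : 0 ≤ (1 - D.p) ^ k * D.p * (1 - D.p) ^ i :=
    mul_nonneg (mul_nonneg (pow_nonneg hp k) D.p_pos.le) (pow_nonneg hp i)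
  rw [tsum_subtype, ← ENNReal.summable.sum_add_tsum_nat_add' (k := k + 1), hzero, zero_add,
    geomTail, tsum_congr hshift, ← ENNReal.ofReal_tsum_of_nonneg hnonneg hsum.summable,
    hsum.tsum_eq]

theorem tsum_Ioi_eq_mul_geomTail {f : ℕ → ℝ≥0∞} {a : ℝ≥0∞} {l k : ℕ}
    (hf : ∀ t, l < t → f t = a * D.geomWeight t) (hlk : l ≤ k) :
    ∑' t : Set.Ioi k, f t = a * D.geomTail k := by
  rw [tsum_congr fun t : Set.Ioi k => hf t (hlk.trans_lt t.2), ENNReal.tsum_mul_left,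
    tsum_geomWeight_Ioi]

theorem refTime_le (x : ℕ × NetState N) : D.refTime x ≤ x.1 := min_le_left _ _

theorem totalLoss_stopLoss (x : ℕ × NetState N) (f : ℕ → ℝ≥0∞) :
    totalLoss f (D.decisionProblem.stopLoss x) = ∑' t : Set.Ioi x.1, f t := by
  rw [tsum_subtype _ f]
  exact tsum_congr fun t => by
    rw [decisionProblem, ← Set.indicator_mul_right, Pi.one_def]
    simp only [mul_one]

/-- Weights of the change times with total `r` up to the reference time of `x`, in proportion to
the geometric law later on, and with total `1` later than `x.1`. -/
noncomputable def oddsWeights (x : ℕ × NetState N) (r : ℝ≥0∞) (t : ℕ) : ℝ≥0∞ :=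
  if t = 0 then r else if D.refTime x < t then (D.geomTail x.1)⁻¹ * D.geomWeight t else 0

theorem oddsWeights_of_lt {x : ℕ × NetState N} {t : ℕ} (ht : D.refTime x < t) (r : ℝ≥0∞) :
    D.oddsWeights x r t = (D.geomTail x.1)⁻¹ * D.geomWeight t := by
  rw [oddsWeights, if_neg (Nat.ne_zero_of_lt ht), if_pos ht]

theorem tsum_oddsWeights_Iic (x : ℕ × NetState N) (r : ℝ≥0∞) :
    ∑' t : Set.Iic (D.refTime x), D.oddsWeights x r t = r := by
  rw [tsum_eq_single ⟨0, Nat.zero_le _⟩ fun t ht => ?_]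
  · exact if_pos rfl
  · rw [oddsWeights, if_neg fun h => ht (Subtype.ext h), if_neg t.2.not_gt]

theorem oddsWeights_mono (x : ℕ × NetState N) : Monotone (D.oddsWeights x) := fun r r' h t => by
  unfold oddsWeights
  split_ifs <;> first | exact h | exact le_rfl

theorem oddsWeights_add (x : ℕ × NetState N) (r ε : ℝ≥0∞) :
    D.oddsWeights x (r + ε) = D.oddsWeights x r + Pi.single 0 ε := by
  ext t
  by_cases ht : t = 0 <;> simp [oddsWeights, ht]

theorem totalLoss_oddsWeights_stopLoss (x : ℕ × NetState N) (r : ℝ≥0∞) :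
    totalLoss (D.oddsWeights x r) (D.decisionProblem.stopLoss x) = 1 := by
  rw [totalLoss_stopLoss, D.tsum_Ioi_eq_mul_geomTail (fun t ht => D.oddsWeights_of_lt ht r)
    (D.refTime_le x), ENNReal.inv_mul_cancel (D.geomTail_ne_zero _) (D.geomTail_ne_top _)]

/-- The least odds of a change from which on stopping at once is optimal. -/
noncomputable def criticalOdds (x : ℕ × NetState N) : ℝ≥0∞ :=
  sInf {r | D.decisionProblem.StopOptimal x (D.oddsWeights x r)}

theorem stopOptimal_oddsWeights_iff (x : ℕ × NetState N) {r : ℝ≥0∞} (hr : r ≠ ∞) :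
    D.decisionProblem.StopOptimal x (D.oddsWeights x r) ↔ D.criticalOdds x ≤ r := by
  refine ⟨fun h => sInf_le h, fun h n => ?_⟩
  rw [totalLoss_oddsWeights_stopLoss]
  set C : ℝ≥0∞ := 1 + n * ENNReal.ofReal D.c + ENNReal.ofReal D.c with hC
  have hC_top : C ≠ ∞ := by
    rw [hC]
    finiteness
  have hbound (ε : ℝ≥0∞) (hε : 0 < ε) :
      1 ≤ D.decisionProblem.contCost n x (D.oddsWeights x r) + C * ε := by
    obtain ⟨r', hr', hlt⟩ := sInf_lt_iff.1 (h.trans_lt (ENNReal.lt_add_right hr hε.ne'))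
    calc 1 = totalLoss (D.oddsWeights x r') (D.decisionProblem.stopLoss x) :=
          (D.totalLoss_oddsWeights_stopLoss x r').symm
      _ ≤ D.decisionProblem.contCost n x (D.oddsWeights x r') := hr' n
      _ ≤ D.decisionProblem.contCost n x (D.oddsWeights x (r + ε)) :=
          D.decisionProblem.contCost_mono n x (D.oddsWeights_mono x hlt.le)
      _ ≤ D.decisionProblem.contCost n x (D.oddsWeights x r) + C * ∑' t, Pi.single 0 ε t := by
          rw [oddsWeights_add]
          exact BayesStopping.contCost_add_le D.stopLoss_le D.runLoss_le n x _ _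
      _ = D.decisionProblem.contCost n x (D.oddsWeights x r) + C * ε := by
          rw [tsum_pi_single]
  have hlim : Tendsto (fun ε => D.decisionProblem.contCost n x (D.oddsWeights x r) + C * ε)
      (𝓝[>] 0) (𝓝 (D.decisionProblem.contCost n x (D.oddsWeights x r) + C * 0)) :=
    ((continuous_const.add (ENNReal.continuous_const_mul hC_top)).tendsto 0).mono_left
      nhdsWithin_le_nhds
  rw [mul_zero, add_zero] at hlim
  exact ge_of_tendsto hlim (eventually_mem_nhdsWithin.mono hbound)

/-- The ratio of the prior probabilities, given that no change has occurred up to time `0`, of no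
change up to the reference time and of no change up to `x.1`. -/
noncomputable def tailRatio (x : ℕ × NetState N) : ℝ≥0∞ :=
  D.geomTail (D.refTime x) / D.geomTail x.1

theorem tailRatio_ne_top (x : ℕ × NetState N) : D.tailRatio x ≠ ∞ :=
  ENNReal.div_ne_top (D.geomTail_ne_top _) (D.geomTail_ne_zero _)

/-- The least posterior probability of a change at which stopping is optimal. The total of the
weights `oddsWeights x r` is `r + tailRatio x`. -/
noncomputable def stopThreshold (x : ℕ × NetState N) : ℝ :=
  (1 - (D.criticalOdds x + D.tailRatio x)⁻¹).toReal

theorem stopThreshold_mem_Icc (x : ℕ × NetState N) : D.stopThreshold x ∈ Set.Icc 0 1 :=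
  ⟨ENNReal.toReal_nonneg, ENNReal.toReal_le_of_le_ofReal zero_le_one (by simp)⟩

variable {D} {x : ℕ × NetState N} {f : ℕ → ℝ≥0∞} {a : ℝ≥0∞}

theorem mergeEq_oddsWeights (ha : ∀ t, D.refTime x < t → f t = a * D.geomWeight t) {c : ℝ≥0∞}
    (hc : c * a = (D.geomTail x.1)⁻¹) : MergeEq (Set.Iic (D.refTime x)) (c • f)
      (D.oddsWeights x (c * ∑' t : Set.Iic (D.refTime x), f t)) where
  eq_off t ht := by
    have hlt := not_le.1 (mt Set.mem_Iic.2 ht)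
    rw [Pi.smul_apply, smul_eq_mul, ha t hlt, D.oddsWeights_of_lt hlt, ← mul_assoc, hc]
  tsum_eq := by
    simp only [Pi.smul_apply, smul_eq_mul, ENNReal.tsum_mul_left, tsum_oddsWeights_Iic]

theorem stopOptimal_iff_criticalOdds_add_le (hf : ∑' t, f t = 1)
    (ha : ∀ t, D.refTime x < t → f t = a * D.geomWeight t) (h0 : ∑' t : Set.Ioi x.1, f t ≠ 0) :
    D.decisionProblem.StopOptimal x f ↔
      D.criticalOdds x + D.tailRatio x ≤ (∑' t : Set.Ioi x.1, f t)⁻¹ := by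
  have htail := D.tsum_Ioi_eq_mul_geomTail ha (D.refTime_le x)
  have hle (A : Set ℕ) : ∑' t : A, f t ≤ 1 :=
    (ENNReal.tsum_comp_le_tsum_of_injective Subtype.val_injective f).trans_eq hf
  set u := ∑' t : Set.Ioi x.1, f t
  have hu_top : u ≠ ∞ := ne_top_of_le_ne_top ENNReal.one_ne_top (hle _)
  set r := u⁻¹ * ∑' t : Set.Iic (D.refTime x), f t with hr
  have hr_top : r ≠ ∞ := ENNReal.mul_ne_top (ENNReal.inv_ne_top.2 h0)
    (ne_top_of_le_ne_top ENNReal.one_ne_top (hle _))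
  have ha_eq : u⁻¹ * a = (D.geomTail x.1)⁻¹ := by
    rw [← ENNReal.mul_right_inj h0 hu_top, ← mul_assoc, ENNReal.mul_inv_cancel h0 hu_top, one_mul,
      htail, mul_assoc, ENNReal.mul_inv_cancel (D.geomTail_ne_zero _) (D.geomTail_ne_top _),
      mul_one]
  have htotal : r + D.tailRatio x = u⁻¹ := by
    have hsplit : ∑' t : Set.Iic (D.refTime x), f t + ∑' t : Set.Ioi (D.refTime x), f t = 1 := by
      rw [← hf, ← Set.compl_Iic]
      exact ENNReal.summable.tsum_add_tsum_compl ENNReal.summable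
    rw [D.tsum_Ioi_eq_mul_geomTail ha le_rfl] at hsplit
    rw [hr, tailRatio, div_eq_mul_inv, ← ha_eq, mul_comm (D.geomTail _), mul_assoc, ← mul_add,
      hsplit, mul_one]
  rw [← D.decisionProblem.stopOptimal_smul_iff (ENNReal.inv_ne_zero.2 hu_top)
    (ENNReal.inv_ne_top.2 h0),
    D.isIndistinguishable_Iic_refTime.stopOptimal_iff (mergeEq_oddsWeights ha ha_eq),
    D.stopOptimal_oddsWeights_iff x hr_top, ← htotal,
    ENNReal.add_le_add_iff_right (D.tailRatio_ne_top x)]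

theorem stopThreshold_le_iff (hf : ∑' t, f t = 1)
    (ha : ∀ t, D.refTime x < t → f t = a * D.geomWeight t) :
    D.stopThreshold x ≤ (totalLoss f ((Set.Iic x.1).indicator 1)).toReal ↔
      D.decisionProblem.StopOptimal x f := by
  rw [stopThreshold, totalLoss_Iic_eq_one_sub hf,
    ENNReal.toReal_le_toReal (by finiteness) (by finiteness)]
  by_cases h0 : ∑' t : Set.Ioi x.1, f t = 0
  · have h_stopping : D.decisionProblem.StopOptimal x f := fun n => by
      rw [totalLoss_stopLoss, h0]
      exact zero_le
    simp [h0, h_stopping]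
  · have hle : ∑' t : Set.Ioi x.1, f t ≤ 1 :=
      (ENNReal.tsum_comp_le_tsum_of_injective Subtype.val_injective f).trans_eq hf
    rw [stopOptimal_iff_criticalOdds_add_le hf ha h0, ENNReal.le_inv_iff_le_inv,
      ENNReal.sub_le_sub_iff_left hle ENNReal.one_ne_top]

end Thresholds
end Params

section Samples

variable {N : ℕ} {𝒳 : Type*}

/-- An entry of the vector of samples handed over, given the batch it comes from, if any, and the
value of the sample. -/
def entry : Option ℕ → 𝒳 → 𝒳 ⊕ Unit
  | none => fun _ => Sum.inr ()
  | some _ => Sum.inl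

/-- The index of the sample of node `i` handed over as a result of the outcome `o` in the
configuration `s`; if there is none, an index which is never `Received`. -/
noncomputable def handedOverIndex (s : NetState N) (o : Fin (N + 1)) (i : Fin N) : ℕ × Fin N :=
  ((delivered s o i).getD (s.B + 1) - 1, i)

/-- The samples handed over as a result of the outcome `o` in the configuration `s`. Here and
below `x (b, i)` is the sample of node `i` in batch `b + 1`, as batches are numbered from `1`. -/
noncomputable def handedOver (s : NetState N) (o : Fin (N + 1)) (x : ℕ × Fin N → 𝒳) (i : Fin N) :
    𝒳 ⊕ Unit :=
  entry (delivered s o i) (x (handedOverIndex s o i))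

/-- The indices of the samples received in the configuration `s`. -/
def receivedIndices (s : NetState N) : Set (ℕ × Fin N) := {x | Received s (x.1 + 1) x.2}

variable {s : NetState N} {o : Fin (N + 1)} {i : Fin N}

theorem handedOverIndex_injective (s : NetState N) (o : Fin (N + 1)) :
    Function.Injective (handedOverIndex s o) := fun _ _ h => congrArg Prod.snd h

theorem handedOverIndex_fst_add_one (hs : 1 ≤ s.B) {b : ℕ} (h : delivered s o i = some b) :
    (handedOverIndex s o i).1 + 1 = b := by
  have := B_le_of_delivered h
  simp only [handedOverIndex, h, Option.getD_some]
  omega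

theorem handedOverIndex_notMem_receivedIndices (hs : 1 ≤ s.B) :
    handedOverIndex s o i ∉ receivedIndices s := by
  change ¬Received s ((handedOverIndex s o i).1 + 1) i
  cases hd : delivered s o i with
  | none => simp [handedOverIndex, hd, Received]
  | some b =>
    rw [handedOverIndex_fst_add_one hs hd]
    exact not_received_of_delivered hd

theorem monotone_receivedIndices_netState (m : ℕ) (o : ℕ → Fin (N + 1)) :
    Monotone fun k => receivedIndices (netState m o k) :=
  monotone_nat_of_le_succ fun k _ hx => Received.netStep hx m k (o k)

variable [MeasurableSpace 𝒳]

/-- The information carried by the samples with indices in `I`. -/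
abbrev samplesInfo (𝒳 : Type*) [MeasurableSpace 𝒳] (I : Set (ℕ × Fin N)) :
    MeasurableSpace (ℕ × Fin N → 𝒳) :=
  ⨆ x ∈ I, MeasurableSpace.comap (Function.eval x) inferInstance

theorem samplesInfo_mono {I J : Set (ℕ × Fin N)} (h : I ⊆ J) : samplesInfo 𝒳 I ≤ samplesInfo 𝒳 J :=
  biSup_mono h

theorem samplesInfo_le (I : Set (ℕ × Fin N)) : samplesInfo 𝒳 I ≤ MeasurableSpace.pi :=
  iSup₂_le fun x _ => (measurable_pi_apply x).comap_le

theorem measurable_samplesInfo_eval {I : Set (ℕ × Fin N)} {x : ℕ × Fin N} (hx : x ∈ I) :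
    Measurable[samplesInfo 𝒳 I] (Function.eval x : (ℕ × Fin N → 𝒳) → 𝒳) :=
  measurable_iff_comap_le.2 (le_iSup₂_of_le x hx le_rfl)

theorem measurable_entry (d : Option ℕ) : Measurable (entry d : 𝒳 → 𝒳 ⊕ Unit) := by
  cases d with
  | none => exact measurable_const
  | some b => exact measurable_inl

theorem measurable_samplesInfo_handedOver {I : Set (ℕ × Fin N)}
    (h : ∀ i b, delivered s o i = some b → handedOverIndex s o i ∈ I) :
    Measurable[samplesInfo 𝒳 I] (handedOver (𝒳 := 𝒳) s o) := by
  refine @measurable_pi_lambda _ _ _ (samplesInfo 𝒳 I) _ _ fun i => ?_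
  unfold handedOver
  cases hd : delivered s o i with
  | none => exact measurable_const
  | some b => exact measurable_inl.comp (measurable_samplesInfo_eval (h i b hd))

theorem measurable_handedOver_receivedIndices (m k : ℕ) (hs : 1 ≤ s.B) :
    Measurable[samplesInfo 𝒳 (receivedIndices (netStep m k s o))] (handedOver (𝒳 := 𝒳) s o) :=
  measurable_samplesInfo_handedOver fun i b hb => by
    change Received _ ((handedOverIndex s o i).1 + 1) i
    rw [handedOverIndex_fst_add_one hs hb]
    exact received_of_delivered hb m k

theorem measurable_handedOver_compl_receivedIndices (hs : 1 ≤ s.B) :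
    Measurable[samplesInfo 𝒳 (receivedIndices s)ᶜ] (handedOver (𝒳 := 𝒳) s o) :=
  measurable_samplesInfo_handedOver fun _ _ _ => handedOverIndex_notMem_receivedIndices hs

namespace Params

variable (D : Params N 𝒳)

/-- The law of the samples when the change time is `t`. -/
noncomputable def samplesLaw (t : ℕ) : Measure (ℕ × Fin N → 𝒳) :=
  Measure.infinitePi fun x => D.sampleLaw t (x.1 + 1)

theorem map_entry_sampleLaw (t b : ℕ) (d : Option ℕ) (h : ∀ b', d = some b' → b = b') :
    (D.sampleLaw t b).map (entry d) = D.entryLaw t d := by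
  cases d with
  | none => simp [entry, entryLaw, Measure.map_const]
  | some b' => rw [h b' rfl, entry, entryLaw]

theorem map_handedOver_samplesLaw (hs : 1 ≤ s.B) (t : ℕ) :
    (D.samplesLaw t).map (handedOver s o) = D.handedOverLaw t s o := by
  have hidx : Measurable fun (x : ℕ × Fin N → 𝒳) i => x (handedOverIndex s o i) := by fun_prop
  have hentry : Measurable fun (y : Fin N → 𝒳) i => entry (delivered s o i) (y i) :=
    measurable_pi_lambda _ fun i => (measurable_entry _).comp (measurable_pi_apply i)
  change (D.samplesLaw t).map ((fun (y : Fin N → 𝒳) i => entry (delivered s o i) (y i)) ∘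
    fun x i => x (handedOverIndex s o i)) = _
  rw [← Measure.map_map hentry hidx, samplesLaw,
    Measure.map_infinitePi_infinitePi_of_inj (handedOverIndex_injective s o),
    Measure.infinitePi_eq_pi, Measure.pi_map_pi fun i => (measurable_entry _).aemeasurable,
    handedOverLaw]
  congr 1
  ext1 i
  exact D.map_entry_sampleLaw t _ _ fun b hb => handedOverIndex_fst_add_one hs hb

theorem samplesLaw_inter_handedOver (hs : 1 ≤ s.B) (t : ℕ) {A : Set (ℕ × Fin N → 𝒳)}
    (hA : MeasurableSet[samplesInfo 𝒳 (receivedIndices s)] A) {C : Set (Fin N → 𝒳 ⊕ Unit)}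
    (hC : MeasurableSet C) : D.samplesLaw t (A ∩ handedOver s o ⁻¹' C) =
      D.samplesLaw t A * D.handedOverLaw t s o C := by
  have hindep : iIndepFun (fun x => Function.eval x) (D.samplesLaw t) :=
    iIndepFun_infinitePi (P := fun x : ℕ × Fin N => D.sampleLaw t (x.1 + 1))
      (X := fun _ y => y) fun _ => measurable_id
  have hsup := indep_iSup_of_disjoint (fun x => (measurable_pi_apply x).comap_le) hindep.iIndep
    (disjoint_compl_right (a := receivedIndices s))
  have hmeas := measurable_handedOver_compl_receivedIndices (𝒳 := 𝒳) (o := o) hs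
  rw [(Indep_iff _ _ _).1 hsup A _ hA (hmeas hC), ← D.map_handedOver_samplesLaw hs,
    Measure.map_apply (hmeas.mono (samplesInfo_le _) le_rfl) hC]

end Params
end Samples

section Information

variable {Ω 𝒳 : Type*} {N : ℕ}

instance : DiscreteMeasurableSpace (QueueState N) := ⟨fun _ => trivial⟩

instance : Countable (QueueState N) :=
  Function.Injective.countable (f := fun q : QueueState N => (q.lam, q.B, q.Δ, q.W, q.R))
    fun q q' h => by
      simp only [Prod.mk.injEq] at h
      exact QueueState.ext h.1 h.2.1 h.2.2.1 h.2.2.2.1 h.2.2.2.2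

/-- The samples of the batches `1, 2, …`, indexed from `0`. -/
def samples (X : ℕ → Fin N → Ω → 𝒳) (ω : Ω) : ℕ × Fin N → 𝒳 := fun x => X (x.1 + 1) x.2 ω

/-- The event that the outcomes of the slots before slot `k` are `o 0, o 1, …`. -/
def pathEvent (M : ℕ → Ω → Fin (N + 1)) (o : ℕ → Fin (N + 1)) (k : ℕ) : Set Ω :=
  {ω | ∀ l, l < k → M l ω = o l}

/-- What the decision maker learns from slot `k`. -/
noncomputable def slotObs (m : ℕ) (M : ℕ → Ω → Fin (N + 1)) (X : ℕ → Fin N → Ω → 𝒳) (k : ℕ)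
    (ω : Ω) : SlotObs N 𝒳 :=
  (M k ω, Y m M X (k + 1) ω)

variable {m k : ℕ} {M : ℕ → Ω → Fin (N + 1)} {X : ℕ → Fin N → Ω → 𝒳} {o : ℕ → Fin (N + 1)} {ω : Ω}

theorem pathEvent_congr {o' : ℕ → Fin (N + 1)} (h : ∀ l < k, o l = o' l) :
    pathEvent M o k = pathEvent M o' k := by
  ext ω
  simp +contextual [pathEvent, h]

theorem pathEvent_succ (M : ℕ → Ω → Fin (N + 1)) (o : ℕ → Fin (N + 1)) (k : ℕ) :
    pathEvent M o (k + 1) = M k ⁻¹' {o k} ∩ pathEvent M o k := by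
  ext ω
  exact Nat.forall_lt_succ_right.trans and_comm

theorem Y_succ (m : ℕ) (M : ℕ → Ω → Fin (N + 1)) (X : ℕ → Fin N → Ω → 𝒳) (k : ℕ) (ω : Ω) :
    Y m M X (k + 1) ω = handedOver (netState m (M · ω) k) (M k ω) (samples X ω) := by
  ext1 i
  simp only [Y, handedOver]
  cases hd : delivered (netState m (M · ω) k) (M k ω) i with
  | none => rfl
  | some b =>
    simp only [entry, samples, handedOverIndex_fst_add_one (one_le_netState_B m _ k) hd]
    rfl

variable [MeasurableSpace 𝒳]

theorem exists_Z_eq (m : ℕ) (M : ℕ → Ω → Fin (N + 1)) (X : ℕ → Fin N → Ω → 𝒳)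
    (o : ℕ → Fin (N + 1)) (k : ℕ) : ∃ g : (ℕ × Fin N → 𝒳) → QueueState N × (Fin N → 𝒳 ⊕ Unit),
      Measurable[samplesInfo 𝒳 (receivedIndices (netState m o k))] g ∧
        ∀ ω ∈ pathEvent M o k, Z m M X k ω = g (samples X ω) := by
  have hQ {k : ℕ} {ω : Ω} (hω : ω ∈ pathEvent M o k) : Q m M k ω = queueState m o k := by
    simp only [Q, queueState, netState_congr hω]
  cases k with
  | zero => exact ⟨fun _ => (queueState m o 0, fun _ => Sum.inr ()), measurable_const,
    fun _ hω => Prod.ext (hQ hω) rfl⟩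
  | succ k =>
    refine ⟨fun x => (queueState m o (k + 1), handedOver (netState m o k) (o k) x),
      measurable_const.prodMk
        (measurable_handedOver_receivedIndices m k (one_le_netState_B m o k)),
      fun ω hω => Prod.ext (hQ hω) ?_⟩
    simp only [Z, Y_succ, hω k k.lt_succ_self,
      netState_congr fun l hl => hω l (hl.trans k.lt_succ_self)]

variable [MeasurableSpace Ω]

theorem measurableSet_pathEvent (hM : ∀ k, Measurable (M k)) (o : ℕ → Fin (N + 1)) (k : ℕ) :
    MeasurableSet (pathEvent M o k) := by
  have heq : pathEvent M o k = ⋂ l, ⋂ _ : l < k, M l ⁻¹' {o l} := by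
    ext ω
    simp [pathEvent]
  exact heq ▸ .iInter fun l => .iInter fun _ => hM l (measurableSet_singleton (o l))

variable (hM : ∀ k, Measurable (M k)) (hX : ∀ b i, Measurable (X b i))

theorem exists_samples_preimage_inter_pathEvent (o : ℕ → Fin (N + 1)) (k : ℕ) {A : Set Ω}
    (hA : MeasurableSet[information (m := m) hM hX k] A) :
    ∃ A', MeasurableSet[samplesInfo 𝒳 (receivedIndices (netState m o k))] A' ∧
      A ∩ pathEvent M o k = samples X ⁻¹' A' ∩ pathEvent M o k := by
  have hle : (information (m := m) hM hX k).comap ((↑) : pathEvent M o k → Ω) ≤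
      (samplesInfo 𝒳 (receivedIndices (netState m o k))).comap
        fun ω : pathEvent M o k => samples X (ω : Ω) := by
    refine MeasurableSpace.comap_le_iff_le_map.2 (iSup₂_le fun l hl => ?_)
    rw [← MeasurableSpace.comap_le_iff_le_map, MeasurableSpace.comap_comp]
    obtain ⟨g, hg, hZ⟩ := exists_Z_eq m M X o l
    have heq : Z m M X l ∘ ((↑) : pathEvent M o k → Ω) =
        g ∘ fun ω : pathEvent M o k => samples X (ω : Ω) :=
      funext fun ω => hZ ω fun j hj => ω.2 j (hj.trans_le hl)
    rw [heq, ← MeasurableSpace.comap_comp]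
    exact MeasurableSpace.comap_mono
      (hg.comap_le.trans (samplesInfo_mono (monotone_receivedIndices_netState m o hl)))
  obtain ⟨A', hA', heq⟩ := hle _ ⟨A, hA, rfl⟩
  exact ⟨A', hA', by
    rw [Set.inter_comm A, Set.inter_comm (samples X ⁻¹' A')]
    exact (Subtype.preimage_coe_eq_preimage_coe_iff.1 heq.symm)⟩

theorem measurable_Z_information (k : ℕ) : Measurable[information (m := m) hM hX k] (Z m M X k) :=
  measurable_iff_comap_le.2
    (le_iSup₂ (f := fun l (_ : l ≤ k) => MeasurableSpace.comap (Z m M X l) inferInstance) k le_rfl)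

theorem measurable_outcome_information {k : ℕ}
    (hs : Measurable[information (m := m) hM hX k] fun ω => netState m (M · ω) k) :
    Measurable[information (m := m) hM hX (k + 1)] (M k) := by
  refine @measurable_to_countable' _ _ _ _ (information (m := m) hM hX (k + 1)) _ fun o => ?_
  have hpair : Measurable[information (m := m) hM hX (k + 1)]
      fun ω => (netState m (M · ω) k, Q m M (k + 1) ω) :=
    (hs.mono ((information hM hX).mono k.le_succ) le_rfl).prodMk
      (measurable_fst.comp (measurable_Z_information hM hX (k + 1)))
  have heq : M k ⁻¹' {o} = (fun ω => (netState m (M · ω) k, Q m M (k + 1) ω)) ⁻¹'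
      {x | x.2.B = (netStep m k x.1 o).B ∧ x.2.W = (netStep m k x.1 o).W ∧
        x.2.R = (netStep m k x.1 o).R} := by
    ext ω
    exact ⟨fun h => h ▸ ⟨rfl, rfl, rfl⟩, fun ⟨hB, hW, hR⟩ => eq_of_netStep_eq hB hW hR⟩
  rw [heq]
  exact hpair (Set.to_countable _).measurableSet

theorem measurable_netState_information (k : ℕ) :
    Measurable[information (m := m) hM hX k] fun ω => netState m (M · ω) k := by
  induction k with
  | zero => exact measurable_const
  | succ k ih =>
    exact (measurable_of_countable fun x : NetState N × Fin (N + 1) => netStep m k x.1 x.2).comp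
      ((ih.mono ((information hM hX).mono k.le_succ) le_rfl).prodMk
        (measurable_outcome_information hM hX ih))

theorem information_zero : information (m := m) hM hX 0 = ⊥ := by
  change ⨆ l ≤ 0, MeasurableSpace.comap (Z m M X l) _ = ⊥
  simp only [Nat.le_zero, iSup_iSup_eq_left]
  exact MeasurableSpace.comap_const
    ((queueState m (fun _ => 0) 0, fun _ => Sum.inr ()) : QueueState N × (Fin N → 𝒳 ⊕ Unit))

theorem information_succ (k : ℕ) : information (m := m) hM hX (k + 1) =
    information (m := m) hM hX k ⊔ MeasurableSpace.comap (slotObs m M X k) inferInstance := by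
  have hsucc : information (m := m) hM hX (k + 1) =
      information (m := m) hM hX k ⊔ MeasurableSpace.comap (Z m M X (k + 1)) inferInstance :=
    Nat.iSup_le_succ (fun l => MeasurableSpace.comap (Z m M X l) inferInstance) k
  refine le_antisymm (hsucc.trans_le (sup_le le_sup_left (Measurable.comap_le ?_)))
    (sup_le ((information hM hX).mono k.le_succ) (Measurable.comap_le ?_))
  · have hobs : Measurable[information (m := m) hM hX k ⊔
        MeasurableSpace.comap (slotObs m M X k) inferInstance] (slotObs m M X k) :=
      (comap_measurable _).mono le_sup_right le_rfl
    have hstate := (measurable_netState_information (m := m) hM hX k).mono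
      (le_sup_left (b := MeasurableSpace.comap (slotObs m M X k) inferInstance)) le_rfl
    exact ((measurable_of_countable fun x : NetState N × Fin (N + 1) =>
      observedState m (k + 1) (netStep m k x.1 x.2)).comp
        (hstate.prodMk (measurable_fst.comp hobs))).prodMk (measurable_snd.comp hobs)
  · exact (measurable_outcome_information hM hX (measurable_netState_information hM hX k)).prodMk
      (measurable_snd.comp (measurable_Z_information hM hX (k + 1)))

end Information

section Law

variable {Ω 𝒳 : Type*} [MeasurableSpace Ω] [MeasurableSpace 𝒳] {N : ℕ} {D : Params N 𝒳} {ρ : ℝ}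
  {μ : Measure Ω} {T : Ω → ℕ} {M : ℕ → Ω → Fin (N + 1)} {X : ℕ → Fin N → Ω → 𝒳}

theorem measure_univ_eq_of_forall_pathEvent {ν ν' : Measure Ω} (hM : ∀ k, Measurable (M k)) (k : ℕ)
    (h : ∀ o, ν (pathEvent M o k) = ν' (pathEvent M o k)) : ν Set.univ = ν' Set.univ := by
  have hg : Measurable fun ω (l : Fin k) => M l ω := measurable_pi_lambda _ fun l => hM l
  have hfiber (x : Fin k → Fin (N + 1)) : (fun ω (l : Fin k) => M l ω) ⁻¹' {x} =
      pathEvent M (fun l => if hl : l < k then x ⟨l, hl⟩ else 0) k := by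
    ext ω
    simp +contextual [pathEvent, funext_iff, Fin.forall_iff]
  have hmap : ν.map (fun ω (l : Fin k) => M l ω) = ν'.map fun ω (l : Fin k) => M l ω :=
    Measure.ext_of_singleton fun x => by
      rw [Measure.map_apply hg (measurableSet_singleton x),
        Measure.map_apply hg (measurableSet_singleton x), hfiber, h]
  simpa only [Measure.map_apply hg .univ, Set.preimage_univ] using
    congrArg (fun ν => ν Set.univ) hmap

namespace IsModel

variable (h : IsModel D.m D.σ D.p ρ D.F₀ D.F₁ μ T M X)
include h

theorem measurable_samples : Measurable (samples X) :=
  measurable_pi_lambda _ fun x => h.measurable_X (x.1 + 1) x.2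

theorem measurableSet_fiber (t : ℕ) : MeasurableSet (T ⁻¹' {t}) :=
  h.measurable_T (measurableSet_singleton t)

variable [IsProbabilityMeasure μ]

theorem measure_samples_pi (t : ℕ) (s : Finset (ℕ × Fin N)) {A : ℕ × Fin N → Set 𝒳}
    (hA : ∀ x, MeasurableSet (A x)) : μ (T ⁻¹' {t} ∩ samples X ⁻¹' Set.pi s A) =
      μ (T ⁻¹' {t}) * ∏ x ∈ s, D.sampleLaw t (x.1 + 1) (A x) := by
  classical
  let E (x : ℕ × Fin N) : Set 𝒳 := if x ∈ s then A x else Set.univ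
  obtain ⟨n, hn⟩ : ∃ n, ∀ x ∈ s, x.1 < n :=
    ⟨s.sup Prod.fst + 1, fun x hx => Nat.lt_succ_of_le (Finset.le_sup (f := Prod.fst) hx)⟩
  have hlaw := h.law_X t n (fun b i => E (b - 1, i)) fun b i => by
    dsimp only [E]
    split_ifs
    exacts [hA _, .univ]
  have hset : {ω | T ω = t ∧ ∀ b ∈ Finset.Icc 1 n, ∀ i, X b i ω ∈ E (b - 1, i)} =
      T ⁻¹' {t} ∩ samples X ⁻¹' Set.pi s A := by
    ext ω
    refine and_congr_right fun _ => ⟨fun hω x hx => ?_, fun hω b hb i => ?_⟩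
    · simpa [E, Finset.mem_coe.1 hx, samples] using hω (x.1 + 1) (by simpa using hn x hx) x.2
    · obtain ⟨b, rfl⟩ := Nat.exists_eq_add_of_le' (Finset.mem_Icc.1 hb).1
      by_cases hx : (b, i) ∈ s
      · simpa [E, hx, samples] using hω (b, i) hx
      · simp [E, hx]
  have hprod : ∏ b ∈ Finset.Icc 1 n, ∏ i, (D.sampleLaw t b).real (E (b - 1, i)) =
      ∏ x ∈ s, (D.sampleLaw t (x.1 + 1)).real (A x) := by
    rw [← Finset.Ico_add_one_right_eq_Icc, ← zero_add 1, ← Finset.prod_Ico_add',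
      ← Finset.range_eq_Ico, ← Finset.prod_product']
    refine (Finset.prod_subset_one_on_sdiff (fun x hx => by simpa using hn x hx)
      (fun x hx => ?_) fun x hx => ?_).symm
    · simp [E, (Finset.mem_sdiff.1 hx).2]
    · simp [E, hx]
  rw [hset] at hlaw
  have hreal := hlaw.trans (congrArg _ hprod)
  simp only [Measure.real, ← ENNReal.toReal_mul, ← ENNReal.toReal_prod] at hreal
  exact (ENNReal.toReal_eq_toReal_iff' (measure_ne_top μ _) (ENNReal.mul_ne_top (measure_ne_top μ _)
    (ENNReal.prod_ne_top fun _ _ => measure_ne_top _ _))).1 hreal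

theorem measure_samples (t : ℕ) {A : Set (ℕ × Fin N → 𝒳)} (hA : MeasurableSet A) :
    μ (T ⁻¹' {t} ∩ samples X ⁻¹' A) = μ (T ⁻¹' {t}) * D.samplesLaw t A := by
  rcases eq_or_ne (μ (T ⁻¹' {t})) 0 with h0 | h0
  · rw [h0, zero_mul]
    exact measure_inter_null_of_null_left _ h0
  have hlaw : (μ[|T ⁻¹' {t}]).map (samples X) = D.samplesLaw t :=
    Measure.eq_infinitePi _ fun s A hA => by
      rw [Measure.map_apply h.measurable_samples (.pi s.countable_toSet fun x _ => hA x),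
        cond_apply (h.measurableSet_fiber t), h.measure_samples_pi t s hA,
        ENNReal.inv_mul_cancel_left h0 (measure_ne_top μ _)]
  rw [← hlaw, Measure.map_apply h.measurable_samples hA, mul_comm,
    cond_mul_eq_inter (h.measurableSet_fiber t)]

theorem measure_pathEvent_inter_samples (t : ℕ) (o : ℕ → Fin (N + 1)) (k : ℕ)
    {A : Set (ℕ × Fin N → 𝒳)} (hA : MeasurableSet A) :
    μ (T ⁻¹' {t} ∩ samples X ⁻¹' A ∩ pathEvent M o k) =
      μ (T ⁻¹' {t}) * D.samplesLaw t A * μ (pathEvent M o k) := by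
  have hB : MeasurableSet {x : ℕ × (ℕ → Fin N → 𝒳) | x.1 = t ∧ Function.uncurry x.2 ∈ A} := by
    have huncurry : Measurable fun (x : ℕ × (ℕ → Fin N → 𝒳)) => Function.uncurry x.2 := by
      fun_prop
    exact (measurable_fst (measurableSet_singleton t)).inter (huncurry hA)
  have hG : MeasurableSet (pathEvent (fun k (x : ℕ → Fin (N + 1)) => x k) o k) :=
    measurableSet_pathEvent measurable_pi_apply o k
  rw [← h.measure_samples t hA, mul_comm, Set.inter_comm]
  exact h.indep.measure_inter_preimage_eq_mul _ _ hG hB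

theorem measure_pathEvent_succ (o : ℕ → Fin (N + 1)) (k : ℕ) : μ (pathEvent M o (k + 1)) =
    μ (pathEvent M o k) * ENNReal.ofReal (outcomeProb D.σ (netState D.m o k) (o k)) := by
  rw [← ofReal_measureReal, ← ofReal_measureReal, ← ENNReal.ofReal_mul measureReal_nonneg]
  exact congrArg _ (h.law_M k o)

theorem ae_outcomeProb_ne_zero (k : ℕ) :
    ∀ᵐ ω ∂μ, outcomeProb D.σ (netState D.m (M · ω) k) (M k ω) ≠ 0 := by
  rw [ae_iff, ← Measure.restrict_apply_univ]
  refine measure_univ_eq_of_forall_pathEvent (ν' := 0) h.measurable_M (k + 1) fun o => ?_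
  rw [Measure.restrict_apply (measurableSet_pathEvent h.measurable_M o (k + 1))]
  by_cases ho : outcomeProb D.σ (netState D.m o k) (o k) = 0
  · refine measure_inter_null_of_null_left _ ?_
    rw [h.measure_pathEvent_succ, ho, ENNReal.ofReal_zero, mul_zero]
  · refine measure_mono_null (fun ω hω => ?_) measure_empty
    refine hω.2 fun h0 => ho ?_
    rwa [netState_congr fun l hl => hω.1 l (hl.trans k.lt_succ_self),
      hω.1 k k.lt_succ_self] at h0

theorem ae_possible : ∀ᵐ ω ∂μ, ∀ k, Possible (netState D.m (M · ω) k) (M k ω) :=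
  ae_all_iff.2 fun k => (h.ae_outcomeProb_ne_zero k).mono fun _ =>
    possible_of_outcomeProb_ne_zero

theorem ae_reachable : ∀ᵐ ω ∂μ, ∀ k, Reachable D.m k (netState D.m (M · ω) k) :=
  h.ae_possible.mono fun _ hω k => Reachable.netState D.one_le_m k fun l _ => hω l

theorem measure_slotObs_inter_pathEvent_succ (t : ℕ) (o : ℕ → Fin (N + 1)) (k : ℕ) {A : Set Ω}
    (hA : MeasurableSet[information (m := D.m) h.measurable_M h.measurable_X k] A)
    {C : Set (SlotObs N 𝒳)} (hC : MeasurableSet C) :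
    μ (T ⁻¹' {t} ∩ A ∩ slotObs D.m M X k ⁻¹' C ∩ pathEvent M o (k + 1)) =
      μ (T ⁻¹' {t} ∩ A ∩ pathEvent M o k) *
        (ENNReal.ofReal (outcomeProb D.σ (netState D.m o k) (o k)) *
          D.handedOverLaw t (netState D.m o k) (o k) (Prod.mk (o k) ⁻¹' C)) := by
  have hs := one_le_netState_B D.m o k
  obtain ⟨A', hA', heq⟩ :=
    exists_samples_preimage_inter_pathEvent h.measurable_M h.measurable_X o k hA
  have hCo : MeasurableSet (Prod.mk (o k) ⁻¹' C) := measurable_prodMk_left hC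
  have hobs : T ⁻¹' {t} ∩ A ∩ slotObs D.m M X k ⁻¹' C ∩ pathEvent M o (k + 1) =
      T ⁻¹' {t} ∩ samples X ⁻¹' (A' ∩ handedOver (netState D.m o k) (o k) ⁻¹'
        (Prod.mk (o k) ⁻¹' C)) ∩ pathEvent M o (k + 1) := by
    ext ω
    simp only [Set.mem_inter_iff, and_congr_left_iff]
    intro hω
    have hpath : ω ∈ pathEvent M o k := fun l hl => hω l (hl.trans k.lt_succ_self)
    have hAω : ω ∈ A ↔ samples X ω ∈ A' := by
      simpa [hpath] using Set.ext_iff.1 heq ω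
    simp only [Set.mem_preimage, Set.mem_inter_iff, slotObs, Y_succ, netState_congr hpath,
      hω k k.lt_succ_self, hAω, and_assoc]
  rw [hobs, h.measure_pathEvent_inter_samples t o (k + 1) ((samplesInfo_le _ _ hA').inter
      (((measurable_handedOver_compl_receivedIndices hs).mono (samplesInfo_le _) le_rfl) hCo)),
    D.samplesLaw_inter_handedOver hs t hA' hCo, h.measure_pathEvent_succ, Set.inter_assoc, heq,
    ← Set.inter_assoc, h.measure_pathEvent_inter_samples t o k (samplesInfo_le _ _ hA')]
  ring

theorem measure_slotObs_inter_pathEvent (t : ℕ) (o : ℕ → Fin (N + 1)) (k : ℕ) {A : Set Ω}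
    (hA : MeasurableSet[information (m := D.m) h.measurable_M h.measurable_X k] A)
    {C : Set (SlotObs N 𝒳)} (hC : MeasurableSet C) :
    μ (T ⁻¹' {t} ∩ A ∩ slotObs D.m M X k ⁻¹' C ∩ pathEvent M o k) =
      μ (T ⁻¹' {t} ∩ A ∩ pathEvent M o k) * D.slotLaw (netState D.m o k) t C := by
  have hpath (j : Fin (N + 1)) {l : ℕ} (hl : l < k) : Function.update o k j l = o l :=
    Function.update_of_ne hl.ne _ _
  have hstate (j : Fin (N + 1)) : netState D.m (Function.update o k j) k = netState D.m o k :=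
    netState_congr fun l hl => hpath j hl
  have h_initial (j : Fin (N + 1)) : pathEvent M (Function.update o k j) k = pathEvent M o k :=
    pathEvent_congr fun l hl => hpath j hl
  have hsucc (j : Fin (N + 1)) : pathEvent M (Function.update o k j) (k + 1) =
      M k ⁻¹' {j} ∩ pathEvent M o k := by
    rw [pathEvent_succ, Function.update_self, h_initial]
  have hsum := sum_measure_preimage_singleton
    (μ := μ.restrict (T ⁻¹' {t} ∩ A ∩ slotObs D.m M X k ⁻¹' C ∩ pathEvent M o k)) Finset.univ
    fun j _ => h.measurable_M k (measurableSet_singleton j)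
  rw [Finset.coe_univ, Set.preimage_univ, Measure.restrict_apply_univ] at hsum
  rw [← hsum, D.slotLaw_apply _ t hC, Finset.mul_sum]
  refine Finset.sum_congr rfl fun j _ => ?_
  rw [Measure.restrict_apply (h.measurable_M k (measurableSet_singleton j)),
    Set.inter_left_comm, ← hsucc, h.measure_slotObs_inter_pathEvent_succ t _ k hA hC, h_initial,
    hstate, Function.update_self]

theorem isObservation (k : ℕ) : D.decisionProblem.IsObservation μ T
    (information (m := D.m) h.measurable_M h.measurable_X k)
    (fun ω => (k, netState D.m (M · ω) k)) (slotObs D.m M X k) where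
  measurable_state := measurable_const.prodMk
    (measurable_netState_information h.measurable_M h.measurable_X k)
  measurable_obs := (h.measurable_M k).prodMk
    (measurable_snd.comp (measurable_Z h.measurable_M h.measurable_X (k + 1)))
  measure_inter t A C hA hC := by
    have hTA := (h.measurableSet_fiber t).inter
      ((information h.measurable_M h.measurable_X).le k _ hA)
    rw [← setLIntegral_univ, ← withDensity_apply _ .univ, ← Measure.restrict_apply_univ]
    refine measure_univ_eq_of_forall_pathEvent h.measurable_M k fun o => ?_
    have hpath := measurableSet_pathEvent h.measurable_M o k
    rw [Measure.restrict_apply hpath, withDensity_apply _ hpath, Set.inter_comm,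
      h.measure_slotObs_inter_pathEvent t o k hA hC, Measure.restrict_restrict hpath,
      setLIntegral_congr_fun (g := fun _ => D.slotLaw (netState D.m o k) t C) (hpath.inter hTA)
        fun ω hω => ?_, setLIntegral_const, Set.inter_comm, mul_comm]
    change D.slotLaw (netState D.m (M · ω) k) t C = _
    rw [netState_congr hω.1]

theorem isRealization : D.decisionProblem.IsRealization μ T
    (information (m := D.m) h.measurable_M h.measurable_X)
    (fun k ω => (k, netState D.m (M · ω) k)) (slotObs D.m M X) where
  filtration_zero := information_zero h.measurable_M h.measurable_X
  filtration_succ := information_succ h.measurable_M h.measurable_X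
  isObservation := h.isObservation
  state_succ _ _ := rfl

end IsModel
end Law

section Risk

open Filter Topology

variable {Ω : Type*} [MeasurableSpace Ω] {μ : Measure Ω} {T : Ω → ℕ} {τ : Ω → ℕ∞}

theorem measure_natCast_lt_eq_tsum (hT : Measurable T)
    (hτ : ∀ k : ℕ, MeasurableSet {ω | τ ω = k}) :
    μ {ω | τ ω < T ω} = ∑' k : ℕ, ∫⁻ ω in {ω | τ ω = k}, (Set.Ioi k).indicator 1 (T ω) ∂μ := by
  have hunion : {ω | τ ω < T ω} = ⋃ k : ℕ, T ⁻¹' Set.Ioi k ∩ {ω | τ ω = k} := by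
    ext ω
    simp only [Set.mem_ofPred_eq, Set.mem_iUnion, Set.mem_inter_iff, Set.mem_preimage, Set.mem_Ioi]
    refine ⟨fun hω => ?_, fun ⟨k, hk, hτk⟩ => hτk ▸ Nat.cast_lt.2 hk⟩
    obtain ⟨k, hk⟩ := ENat.ne_top_iff_exists.1 hω.ne_top
    exact ⟨k, Nat.cast_lt.1 (hk ▸ hω), hk.symm⟩
  have hdisj : Pairwise (Function.onFun Disjoint fun k : ℕ => T ⁻¹' Set.Ioi k ∩ {ω | τ ω = k}) :=
    fun j k hjk => Set.disjoint_left.2 fun ω hj hk =>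
      hjk (Nat.cast_injective (R := ℕ∞) (hj.2.symm.trans hk.2))
  rw [hunion, measure_iUnion hdisj fun k => (hT measurableSet_Ioi).inter (hτ k)]
  refine tsum_congr fun k => ?_
  rw [← Measure.restrict_apply (hT measurableSet_Ioi),
    ← lintegral_indicator_one (hT measurableSet_Ioi)]
  rfl

theorem tsum_indicator_delay (t : ℕ) (n : ℕ∞) :
    ∑' k : ℕ, {k : ℕ | t ≤ k ∧ k < n}.indicator (1 : ℕ → ℝ≥0∞) k = ((n - t : ℕ∞) : ℝ≥0∞) := by
  rw [← tsum_subtype]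
  simp only [Pi.one_apply]
  rw [ENNReal.tsum_set_one]
  congr 1
  cases n with
  | top =>
    have hIci : {k : ℕ | t ≤ k ∧ (k : ℕ∞) < ⊤} = Set.Ici t := by
      ext k
      simp
    rw [hIci, (Set.Ici_infinite t).encard_eq, ENat.top_sub_natCast]
  | coe n =>
    have hIco : {k : ℕ | t ≤ k ∧ (k : ℕ∞) < n} = Finset.Ico t n := by
      ext k
      simp
    rw [hIco, Set.encard_coe_eq_coe_finsetCard, Nat.card_Ico, ENat.natCast_sub]

theorem mul_lintegral_delay_eq_tsum (hT : Measurable T)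
    (hτ : ∀ k : ℕ, MeasurableSet {ω | k < τ ω}) (c : ℝ≥0∞) :
    c * ∫⁻ ω, ((τ ω - T ω : ℕ∞) : ℝ≥0∞) ∂μ =
      ∑' k : ℕ, ∫⁻ ω in {ω | k < τ ω}, (Set.Iic k).indicator (fun _ => c) (T ω) ∂μ := by
  have hmeas (k : ℕ) : MeasurableSet (T ⁻¹' Set.Iic k ∩ {ω | k < τ ω}) :=
    (hT measurableSet_Iic).inter (hτ k)
  have hdelay (ω : Ω) : ((τ ω - T ω : ℕ∞) : ℝ≥0∞) =
      ∑' k : ℕ, (T ⁻¹' Set.Iic k ∩ {ω | k < τ ω}).indicator 1 ω :=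
    (tsum_indicator_delay (T ω) (τ ω)).symm
  simp only [hdelay]
  rw [lintegral_tsum fun k => (measurable_one.indicator (hmeas k)).aemeasurable,
    ← ENNReal.tsum_mul_left]
  refine tsum_congr fun k => ?_
  rw [lintegral_indicator_one (hmeas k), ← Measure.restrict_apply (hT measurableSet_Iic),
    ← lintegral_indicator_const (hT measurableSet_Iic)]
  rfl

theorem risk_eq_expectedCost {ℱ : Filtration ℕ ‹MeasurableSpace Ω›}
    (hT : Measurable T) (hτ : IsStoppingTime ℱ τ)
    (c : ℝ) : risk c μ T τ = expectedCost μ (fun k ω => (Set.Ioi k).indicator 1 (T ω))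
      (fun k ω => (Set.Iic k).indicator (fun _ => ENNReal.ofReal c) (T ω)) τ := by
  rw [risk, measure_natCast_lt_eq_tsum hT fun k => ℱ.le k _ (measurableSet_eq_natCast hτ k),
    mul_lintegral_delay_eq_tsum hT fun k => ℱ.le k _ (measurableSet_natCast_lt hτ k),
    ← ENNReal.tsum_add]
  rfl

theorem tendsto_lintegral_indicator_Ioi [IsFiniteMeasure μ] (hT : Measurable T) :
    Tendsto (fun k => ∫⁻ ω, (Set.Ioi k).indicator 1 (T ω) ∂μ) atTop (𝓝 0) := by
  have hempty : ⋂ k, T ⁻¹' Set.Ioi k = ∅ := by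
    ext ω
    simpa using ⟨T ω, le_rfl⟩
  have hlim := tendsto_measure_iInter_atTop (μ := μ) (s := fun k => T ⁻¹' Set.Ioi k)
    (fun k => (hT measurableSet_Ioi).nullMeasurableSet)
    (fun j k hjk => Set.preimage_mono (Set.Ioi_subset_Ioi hjk)) ⟨0, measure_ne_top μ _⟩
  rw [hempty, measure_empty] at hlim
  refine hlim.congr fun k => ?_
  rw [Function.comp_apply, ← lintegral_indicator_one (hT measurableSet_Ioi)]
  rfl

end Risk

section ThresholdRule

variable {Ω : Type*} {N : ℕ} {γ : QueueState N → ℝ} {P : ℕ → Ω → ℝ} {q : ℕ → Ω → QueueState N}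
  {ω : Ω} {k : ℕ}

theorem thresholdRule_lt_natCast_iff : thresholdRule γ P q ω < k ↔ ∃ j < k, γ (q j ω) ≤ P j ω := by
  simp only [thresholdRule, sInf_lt_iff, Set.mem_ofPred_eq]
  constructor
  · rintro ⟨_, ⟨j, rfl, hle⟩, hj⟩
    exact ⟨j, Nat.cast_lt.1 hj, hle⟩
  · rintro ⟨j, hj, hle⟩
    exact ⟨j, ⟨j, rfl, hle⟩, Nat.cast_lt.2 hj⟩

theorem thresholdRule_le_natCast_iff : thresholdRule γ P q ω ≤ k ↔ ∃ j ≤ k, γ (q j ω) ≤ P j ω := by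
  rw [← ENat.lt_natCast_add_one_iff, ← Nat.cast_succ, thresholdRule_lt_natCast_iff]
  simp only [Nat.lt_succ_iff]

theorem thresholdRule_eq_natCast_iff (h : k ≤ thresholdRule γ P q ω) :
    thresholdRule γ P q ω = k ↔ γ (q k ω) ≤ P k ω := by
  rw [le_antisymm_iff, and_iff_left h, thresholdRule_le_natCast_iff]
  refine ⟨fun ⟨j, hj, hle⟩ => ?_, fun hle => ⟨k, le_rfl, hle⟩⟩
  obtain hlt | rfl := hj.lt_or_eq
  · exact absurd (thresholdRule_lt_natCast_iff.2 ⟨j, hlt, hle⟩) h.not_gt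
  · exact hle

theorem isStoppingTime_thresholdRule {mΩ : MeasurableSpace Ω} {ℱ : Filtration ℕ mΩ}
    (hq : ∀ k, Measurable[ℱ k] (q k)) (hP : ∀ k, Measurable[ℱ k] (P k)) (γ : QueueState N → ℝ) :
    IsStoppingTime ℱ (thresholdRule γ P q) := fun k => by
  have hunion : {ω | thresholdRule γ P q ω ≤ k} = ⋃ j ∈ Set.Iic k, {ω | γ (q j ω) ≤ P j ω} := by
    ext ω
    simp only [Set.mem_iUnion, exists_prop]
    exact thresholdRule_le_natCast_iff
  have hle (j : ℕ) : MeasurableSet[ℱ j] {ω | γ (q j ω) ≤ P j ω} :=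
    (((measurable_of_countable γ).comp (hq j)).prodMk (hP j)) measurableSet_le'
  have hmeas : MeasurableSet[ℱ k] (⋃ j ∈ Set.Iic k, {ω | γ (q j ω) ≤ P j ω}) :=
    .biUnion (Set.to_countable _) fun j hj => ℱ.mono hj _ (hle j)
  exact hunion ▸ hmeas

end ThresholdRule

section Posterior

variable {Ω 𝒳 : Type*} [MeasurableSpace Ω] [MeasurableSpace 𝒳] {N : ℕ} {D : Params N 𝒳} {ρ : ℝ}
  {μ : Measure Ω} {T : Ω → ℕ} {M : ℕ → Ω → Fin (N + 1)} {X : ℕ → Fin N → Ω → 𝒳}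

/-- The conditional law of the change time given the information available at time `k`. -/
noncomputable def Params.changeTimeLaw (D : Params N 𝒳) (μ : Measure Ω) (T : Ω → ℕ)
    (M : ℕ → Ω → Fin (N + 1)) (X : ℕ → Fin N → Ω → 𝒳) : ℕ → Ω → ℕ → ℝ≥0∞ :=
  D.decisionProblem.posteriorLaw (fun t => μ (T ⁻¹' {t}))
    (fun k ω => (k, netState D.m (M · ω) k)) (slotObs D.m M X)

namespace IsModel

variable (h : IsModel D.m D.σ D.p ρ D.F₀ D.F₁ μ T M X) [IsProbabilityMeasure μ]
include h

theorem measure_fiber {t : ℕ} (ht : 1 ≤ t) :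
    μ (T ⁻¹' {t}) = ENNReal.ofReal (1 - ρ) * D.geomWeight t := by
  have hρ : ρ ≤ 1 := h.law_T_zero ▸ measureReal_le_one
  rw [← ofReal_measureReal, Params.geomWeight, ← ENNReal.ofReal_mul (sub_nonneg.2 hρ)]
  exact congrArg _ (h.law_T_pos t ht)

theorem ae_exists_changeTimeLaw_eq_mul : ∀ᵐ ω ∂μ, ∀ k, ∃ a,
    ∀ t ∈ D.unaffected (k, netState D.m (M · ω) k),
      D.changeTimeLaw μ T M X k ω t = a * μ (T ⁻¹' {t}) := by
  filter_upwards [h.ae_reachable, h.ae_possible, ae_all_iff.2 fun k =>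
    h.isRealization.ae_of_forall_ae_dominating h.measurable_T k D.ae_density_eq_of_mem_unaffected]
    with ω hreach hposs hdensity
  exact BayesStopping.exists_posteriorLaw_eq_mul (P := D.decisionProblem)
    (s := fun k ω => (k, netState D.m (M · ω) k)) (o := slotObs D.m M X)
    D.unaffected_next_subset (fun _ => rfl)
    fun k => hdensity k (hreach k) (hposs k)

theorem isConditionalLaw_changeTimeLaw (k : ℕ) :
    IsConditionalLaw μ T (information (m := D.m) h.measurable_M h.measurable_X k)
      (D.changeTimeLaw μ T M X k) :=
  h.isRealization.isConditionalLaw_posteriorLaw h.measurable_T k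

theorem ae_tsum_changeTimeLaw : ∀ᵐ ω ∂μ, ∀ k, ∑' t, D.changeTimeLaw μ T M X k ω t = 1 :=
  ae_all_iff.2 fun k => (h.isConditionalLaw_changeTimeLaw k).ae_tsum_eq_one
    ((information h.measurable_M h.measurable_X).le k) h.measurable_T

theorem ae_posterior_eq : ∀ᵐ ω ∂μ, ∀ k,
    posterior μ T (information (m := D.m) h.measurable_M h.measurable_X) k ω =
      (totalLoss (D.changeTimeLaw μ T M X k ω) ((Set.Iic k).indicator 1)).toReal :=
  ae_all_iff.2 fun k => (h.isConditionalLaw_changeTimeLaw k).condExp_ae_eq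
    ((information h.measurable_M h.measurable_X).le k) h.measurable_T (Set.Iic k)

theorem ae_stopThreshold_le_posterior_iff : ∀ᵐ ω ∂μ, ∀ k,
    D.stopThreshold (k, netState D.m (M · ω) k) ≤
        posterior μ T (information (m := D.m) h.measurable_M h.measurable_X) k ω ↔
      D.decisionProblem.StopOptimal (k, netState D.m (M · ω) k)
        (D.changeTimeLaw μ T M X k ω) := by
  filter_upwards [h.ae_posterior_eq, h.ae_tsum_changeTimeLaw, h.ae_exists_changeTimeLaw_eq_mul]
    with ω hpost hsum hmul k
  obtain ⟨a, ha⟩ := hmul k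
  rw [hpost k]
  refine Params.stopThreshold_le_iff (a := a * ENNReal.ofReal (1 - ρ)) (hsum k) fun t ht => ?_
  rw [ha t (.inl ht), h.measure_fiber (Nat.one_le_of_lt ht), mul_assoc]

theorem tsum_measure_fiber : ∑' t, μ (T ⁻¹' {t}) = 1 := by
  rw [← measure_iUnion (fun s t hst => Disjoint.preimage T (Set.disjoint_singleton.2 hst))
    h.measurableSet_fiber, ← Set.preimage_iUnion, Set.iUnion_of_singleton, Set.preimage_univ,
    measure_univ]

theorem ae_posterior_eq_of_le : ∀ᵐ ω ∂μ, ∀ k ≤ D.m,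
    posterior μ T (information (m := D.m) h.measurable_M h.measurable_X) k ω =
      1 - (1 - ρ) * (1 - D.p) ^ k := by
  have hρ : 0 ≤ 1 - ρ := sub_nonneg.2 (h.law_T_zero ▸ measureReal_le_one)
  filter_upwards [h.ae_posterior_eq, h.ae_tsum_changeTimeLaw, h.ae_exists_changeTimeLaw_eq_mul]
    with ω hpost hsum hmul k hk
  obtain ⟨a, ha⟩ := hmul k
  replace ha (t : ℕ) := ha t (.inr hk)
  have ha_one : a = 1 := by
    rw [← hsum k, tsum_congr ha, ENNReal.tsum_mul_left, h.tsum_measure_fiber, mul_one]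
  have hlate : ∑' t : Set.Ioi k, D.changeTimeLaw μ T M X k ω t =
      ENNReal.ofReal ((1 - ρ) * (1 - D.p) ^ k) := by
    rw [ENNReal.ofReal_mul hρ]
    refine D.tsum_Ioi_eq_mul_geomTail (fun t ht => ?_) k.zero_le
    rw [ha t, ha_one, one_mul, h.measure_fiber ht]
  have hle : ENNReal.ofReal ((1 - ρ) * (1 - D.p) ^ k) ≤ 1 := hlate ▸
    (ENNReal.tsum_comp_le_tsum_of_injective Subtype.val_injective _).trans_eq (hsum k)
  rw [hpost k, totalLoss_Iic_eq_one_sub (hsum k), hlate, ENNReal.toReal_sub_of_le hle (by simp),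
    ENNReal.toReal_one,
    ENNReal.toReal_ofReal (mul_nonneg hρ (pow_nonneg (sub_nonneg.2 D.p_lt_one.le) k))]

end IsModel
end Posterior

section Optimality

variable {Ω 𝒳 : Type*} [MeasurableSpace Ω] [MeasurableSpace 𝒳] {N : ℕ}

/-- The configuration at time `0`. -/
def startState (N : ℕ) : NetState N := ⟨1, fun _ => 0, fun _ => 0, fun _ => false⟩

namespace Params

variable (D : Params N 𝒳)

/-- The threshold at the initial queueing state, which is displayed at time `0` and possibly again
at the first sampling instant. As the posterior probability of a change is then known to be `ρ` and
`1 - (1 - ρ) * (1 - p) ^ m` respectively, one threshold can serve both instants: it is raised above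
`ρ` if stopping at time `0` is not optimal. -/
noncomputable def initialThreshold (ρ : ℝ) : ℝ :=
  if D.stopThreshold (0, startState N) ≤ ρ then D.stopThreshold (0, startState N)
  else max (D.stopThreshold (D.m, firstSamplingState N)) (1 - (1 - ρ) * (1 - D.p) ^ D.m)

open Classical in
/-- The optimal threshold at the queueing state `q` when the prior probability of a change at time
`0` is `ρ`. The value `0` is assigned to the states that never occur. -/
noncomputable def threshold (ρ : ℝ) (q : QueueState N) : ℝ :=
  if q = initialQueueState N D.m then D.initialThreshold ρ
  else if hq : ∃ x : ℕ × NetState N, Reachable D.m x.1 x.2 ∧ observedState D.m x.1 x.2 = q then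
    D.stopThreshold hq.choose
  else 0

theorem initialThreshold_mem_Icc (ρ : ℝ) : D.initialThreshold ρ ∈ Set.Icc 0 1 := by
  unfold initialThreshold
  split_ifs with h
  · exact D.stopThreshold_mem_Icc _
  · have hρ : ρ ≤ 1 := (not_le.1 h).le.trans (D.stopThreshold_mem_Icc _).2
    exact ⟨le_max_of_le_left (D.stopThreshold_mem_Icc _).1,
      max_le (D.stopThreshold_mem_Icc _).2 (sub_le_self _ (mul_nonneg (sub_nonneg.2 hρ)
        (pow_nonneg (sub_nonneg.2 D.p_lt_one.le) _)))⟩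

theorem threshold_mem_Icc (ρ : ℝ) (q : QueueState N) : D.threshold ρ q ∈ Set.Icc 0 1 := by
  unfold threshold
  split_ifs
  · exact D.initialThreshold_mem_Icc ρ
  · exact D.stopThreshold_mem_Icc _
  · exact ⟨le_rfl, zero_le_one⟩

variable {D} {ρ : ℝ} {k : ℕ} {s : NetState N}

theorem threshold_initialQueueState :
    D.threshold ρ (initialQueueState N D.m) = D.initialThreshold ρ := if_pos rfl

theorem threshold_congr (ρ ρ' : ℝ) {q : QueueState N} (hq : q ≠ initialQueueState N D.m) :
    D.threshold ρ q = D.threshold ρ' q := by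
  rw [threshold, threshold, if_neg hq, if_neg hq]

theorem threshold_observedState (hs : Reachable D.m k s)
    (hini : observedState D.m k s ≠ initialQueueState N D.m) :
    D.threshold ρ (observedState D.m k s) = D.stopThreshold (k, s) := by
  have hex : ∃ x : ℕ × NetState N, Reachable D.m x.1 x.2 ∧
      observedState D.m x.1 x.2 = observedState D.m k s := ⟨(k, s), hs, rfl⟩
  obtain ⟨hreach, heq⟩ := hex.choose_spec
  obtain ⟨hk, hs'⟩ := hs.eq_of_observedState_eq D.one_le_N D.one_le_m hreach heq.symm hini
  rw [threshold, if_neg hini, dif_pos hex, show hex.choose = (k, s) from (Prod.ext hk hs').symm]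

theorem initialThreshold_le_prior_iff :
    D.initialThreshold ρ ≤ ρ ↔ D.stopThreshold (0, startState N) ≤ ρ := by
  unfold initialThreshold
  split_ifs with h
  · rfl
  · refine iff_of_false (fun hle => ?_) h
    have hρ : 0 < 1 - ρ := sub_pos.2 ((not_le.1 h).trans_le (D.stopThreshold_mem_Icc _).2)
    have hpow : (1 - D.p) ^ D.m < 1 := pow_lt_one₀ (sub_nonneg.2 D.p_lt_one.le)
      (sub_lt_self _ D.p_pos) (Nat.one_le_iff_ne_zero.1 D.one_le_m)
    linarith [(max_le_iff.1 hle).2, mul_lt_of_lt_one_right hρ hpow]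

theorem initialThreshold_le_iff_of_lt (h : ρ < D.initialThreshold ρ) :
    D.initialThreshold ρ ≤ 1 - (1 - ρ) * (1 - D.p) ^ D.m ↔
      D.stopThreshold (D.m, firstSamplingState N) ≤ 1 - (1 - ρ) * (1 - D.p) ^ D.m := by
  rw [initialThreshold, if_neg (mt initialThreshold_le_prior_iff.2 h.not_ge), max_le_iff,
    and_iff_left le_rfl]

end Params

variable {D : Params N 𝒳} {ρ : ℝ} {μ : Measure Ω} {T : Ω → ℕ} {M : ℕ → Ω → Fin (N + 1)}
  {X : ℕ → Fin N → Ω → 𝒳}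

theorem IsModel.isStoppingTime_thresholdRule
    (h : IsModel D.m D.σ D.p ρ D.F₀ D.F₁ μ T M X) (γ : QueueState N → ℝ) :
    IsStoppingTime (information (m := D.m) h.measurable_M h.measurable_X) (thresholdRule γ
      (posterior μ T (information (m := D.m) h.measurable_M h.measurable_X)) (Q D.m M)) :=
  NADM.isStoppingTime_thresholdRule
    (fun k => measurable_fst.comp (measurable_Z_information h.measurable_M h.measurable_X k))
    (fun _ => stronglyMeasurable_condExp.measurable) γ

variable [IsProbabilityMeasure μ]

theorem IsModel.ae_threshold_le_posterior_iff
    (h : IsModel D.m D.σ D.p ρ D.F₀ D.F₁ μ T M X) {P : ℕ → Ω → ℝ}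
    (hP : P = posterior μ T (information (m := D.m) h.measurable_M h.measurable_X)) :
    ∀ᵐ ω ∂μ, ∀ k, (∀ j < k, P j ω < D.threshold ρ (Q D.m M j ω)) →
      (D.threshold ρ (Q D.m M k ω) ≤ P k ω ↔
        D.decisionProblem.StopOptimal (k, netState D.m (M · ω) k)
          (D.changeTimeLaw μ T M X k ω)) := by
  subst hP
  filter_upwards [h.ae_reachable, h.ae_stopThreshold_le_posterior_iff, h.ae_posterior_eq_of_le]
    with ω hreach hopt hpost k hrun
  have hQ (j : ℕ) : Q D.m M j ω = observedState D.m j (netState D.m (M · ω) j) := rfl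
  have hQ_zero : Q D.m M 0 ω = initialQueueState N D.m := by
    simp [hQ, observedState_eq_iff, netState, slotsToGo, initialQueueState]
  have hpost_zero := hpost 0 D.m.zero_le
  rw [pow_zero, mul_one, sub_sub_cancel] at hpost_zero
  rw [← hopt k]
  by_cases hini : Q D.m M k ω = initialQueueState N D.m
  · rw [hini, Params.threshold_initialQueueState]
    rcases eq_zero_or_eq_of_observedState_eq_initial D.one_le_m hini with rfl | rfl
    · rw [hpost_zero, Params.initialThreshold_le_prior_iff]
      rfl
    · have hrun_zero := hrun 0 D.one_le_m
      rw [hpost_zero, hQ_zero, Params.threshold_initialQueueState] at hrun_zero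
      rw [hpost D.m le_rfl, Params.initialThreshold_le_iff_of_lt hrun_zero,
        (hreach D.m).eq_firstSamplingState D.one_le_N D.one_le_m]
  · rw [hQ, Params.threshold_observedState (hreach k) (hQ k ▸ hini)]

theorem IsModel.risk_thresholdRule_le (h : IsModel D.m D.σ D.p ρ D.F₀ D.F₁ μ T M X) {τ : Ω → ℕ∞}
    (hτ : IsStoppingTime (information (m := D.m) h.measurable_M h.measurable_X) τ) :
    risk D.c μ T (thresholdRule (D.threshold ρ)
        (posterior μ T (information (m := D.m) h.measurable_M h.measurable_X)) (Q D.m M)) ≤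
      risk D.c μ T τ := by
  have hrule := h.isStoppingTime_thresholdRule (D.threshold ρ)
  rw [risk_eq_expectedCost h.measurable_T hrule, risk_eq_expectedCost h.measurable_T hτ]
  refine h.isRealization.expectedCost_le_expectedCost h.measurable_T ENNReal.one_ne_top
    ENNReal.ofReal_ne_top D.stopLoss_le D.runLoss_le
    (tendsto_lintegral_indicator_Ioi h.measurable_T) hrule ?_ hτ
  filter_upwards [h.ae_threshold_le_posterior_iff rfl] with ω hω k hk
  rw [thresholdRule_eq_natCast_iff hk]
  refine hω k fun j hj => not_le.1 fun hle => hk.not_gt ?_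
  exact thresholdRule_lt_natCast_iff.2 ⟨j, hj, hle⟩

end Optimality

end NADM

/-- The optimal stopping rule is a network-state dependent threshold rule on the posterior
probability of change; the thresholds do not depend on the prior probability `ρ` of a change at
time `0`, except possibly at the initial network state. -/
theorem theorem3 {𝒳 : Type*} [MeasurableSpace 𝒳]
    (N : ℕ) (hN : 1 ≤ N) (m : ℕ) (hm : 1 ≤ m)
    (σ : ℝ) (hσ0 : 0 < σ) (hσ1 : σ < 1)
    (p : ℝ) (hp0 : 0 < p) (hp1 : p < 1)
    (c : ℝ) (hc : 0 < c)
    (F₀ F₁ : Measure 𝒳) [IsProbabilityMeasure F₀] [IsProbabilityMeasure F₁] :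
    ∃ γ : ℝ → NADM.QueueState N → ℝ,
      (∀ ρ q, γ ρ q ∈ Set.Icc (0 : ℝ) 1) ∧
      (∀ ρ ρ' q, q ≠ NADM.initialQueueState N m → γ ρ q = γ ρ' q) ∧
      ∀ ρ ∈ Set.Icc (0 : ℝ) 1,
      ∀ (Ω : Type*) [MeasurableSpace Ω] (μ : Measure Ω) [IsProbabilityMeasure μ]
        (T : Ω → ℕ) (M : ℕ → Ω → Fin (N + 1)) (X : ℕ → Fin N → Ω → 𝒳)
        (h : NADM.IsModel m σ p ρ F₀ F₁ μ T M X),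
        IsStoppingTime (NADM.information (m := m) h.measurable_M h.measurable_X)
          (NADM.thresholdRule (γ ρ)
            (NADM.posterior μ T (NADM.information (m := m) h.measurable_M h.measurable_X))
            (NADM.Q m M)) ∧
        ∀ τ : Ω → ℕ∞,
          IsStoppingTime (NADM.information (m := m) h.measurable_M h.measurable_X) τ →
          NADM.risk c μ T
            (NADM.thresholdRule (γ ρ)
              (NADM.posterior μ T (NADM.information (m := m) h.measurable_M h.measurable_X))
              (NADM.Q m M)) ≤
          NADM.risk c μ T τ := by
  let D : NADM.Params N 𝒳 := ⟨m, σ, p, c, F₀, F₁, hN, hm, ⟨hσ0.le, hσ1.le⟩, hp0, hp1, ‹_›, ‹_›⟩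
  refine ⟨D.threshold, D.threshold_mem_Icc, fun ρ ρ' _ hq => NADM.Params.threshold_congr ρ ρ' hq,
    fun ρ _ Ω _ μ _ T M X h => ?_⟩
  have hD : NADM.IsModel D.m D.σ D.p ρ D.F₀ D.F₁ μ T M X := h
  exact ⟨hD.isStoppingTime_thresholdRule (D.threshold ρ), fun τ hτ => hD.risk_thresholdRule_le hτ⟩
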